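/- **Setting.** Let $X,Y$ be real Hilbert spaces, $X$ separable, $K\colon X\to Y$ compact, $\Sigma$ a bounded injective non-negative self-adjoint operator on $Y$ such that $T:=\Sigma^{-1/2}K$ is bounded. Let $C_0$ be a compact, injective, non-negative self-adjoint operator on $X$ with finite trace, and put $B:=TC_0^{1/2}$, $H:=B^*B$. For $\alpha,\delta>0$ consider the data $z^\delta=Tx+\delta\xi$ with Gaussian white noise $\xi$ on $Y$ and the prior $x\sim\mathcal N(0,\tfrac{\delta^2}{\alpha}C_0)$. The squared posterior contraction at $x^*\in X$ is $$\mathrm{SPC}(\alpha,\delta)=\mathbb E^{x^*}\,\mathbb E^{z^\delta}_\alpha\|x^*-x\|^2,$$ where the inner expectation is over the posterior distribution of $x$ given $z^\delta$ and the outer one over the data $z^\delta=Tx^*+\delta\xi$ generated by $x^*$. **Notation.** An index function is a continuous non-decreasing function on $[0,\infty)$ that vanishes at $0$ and is positive on $(0,\infty)$; $g\prec h$ means that $t\mapsto h(t)/g(t)$ (with value $0$ at $0$) is an index function. A continuous $f\colon[0,\infty)\to[0,\infty)$ is operator concave if $f(\frac{G+G'}2)\ge\frac{f(G)+f(G')}2$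 for all non-negative self-adjoint $G,G'$ (equivalently, for matrices of every order). For an index function $\psi$ put $$\varphi_0(t)=\sqrt t,\quad \Theta(t)=\sqrt t\,\psi(t),\quad f_0(s)=\big((\Theta^2)^{-1}(s)\big)^{1/2},\quad g^2(t)=\Big(\frac{\varphi}{\varphi_0}\Big)^2\big((\Theta^2)^{-1}(t)\big).$$ **Assumptions.** (Link condition) There are an index function $\psi$ and constants $0<m\le1\le M<\infty$ with $m\|\psi(C_0)x\|\le\|Tx\|\le M\|\psi(C_0)x\|$ for all $x\in X$, and $f_0^2$ is operator concave. (Source condition) $x^*=\varphi(C_0)v$ with $\|v\|\le1$ for an index function $\varphi$. (Saturation) $\varphi\prec\Theta^2$. Moreover, one of the following cases applies: 1. (regular) $\varphi_0\prec\varphi\prec\Theta$ and $g^2$ is operator concave; 2. (low order) $1\prec\varphi\prec\varphi_0$ and $\varphi^2$ is operator concave; 3. (high order) for some $u>1$: $\varphi/\varphi_0\prec\Theta^u$, the function $t\mapsto g^2(t^{1/u})$ is operator concave, and, with the same $m,M$ as in the link condition, the lifting condition $m^u\|\Theta^u(C_0)x\|\le\|H^{u/2}x\|\le M^u\|\Theta^u(C_0)x\|$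 holds for all $x\in X$. **Theorem 5.1 (Bound for the SPC).** Let $\kappa=M/m$ in the cases 1 and 2, and $\kappa=\max\{M,1/m\}/m$ in case 3; in case 3 one may also take $\kappa=M/m$ if the right-hand inequality of the lifting condition is an equality for all $x$ (and, trivially, if $mM\ge1$). Then for all $\alpha,\delta>0$ $$\mathrm{SPC}(\alpha,\delta)\le\kappa^2\Big[\varphi^2\big(f_0^2(\alpha)\big)+2\delta^2\operatorname{tr}\big((\alpha I+H)^{-1}f_0^2(H)\big)\Big],$$ and consequently, for all $\delta>0$, $$\inf_{\alpha>0}\mathrm{SPC}(\alpha,\delta)\le\kappa^2\inf_{\alpha>0}\Big[\varphi^2\big(f_0^2(\alpha)\big)+2\delta^2\operatorname{tr}\big((\alpha I+H)^{-1}f_0^2(H)\big)\Big].$$ -/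

import Mathlib

open MeasureTheory ProbabilityTheory Set
open scoped ENNReal InnerProductSpace

noncomputable section

namespace PosteriorContraction

/-! ### Index functions -/

/-- Index function: continuous and non-decreasing on `[0, ∞)`, zero at `0`, and positive on
`(0, ∞)`. Values at negative arguments play no role. -/
structure IsIndexFun (f : ℝ → ℝ) : Prop where
  continuousOn : ContinuousOn f (Ici 0)
  monotoneOn : MonotoneOn f (Ici 0)
  zero : f 0 = 0
  pos : ∀ t, 0 < t → 0 < f t

/-- `g ≺ h`: the quotient `h / g` is an index function (it has the value `0` at `0`). -/
def Prec (g h : ℝ → ℝ) : Prop := IsIndexFun fun t => h t / g t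

/-- `Θ(t) = √t ψ(t)`. -/
def Theta (ψ : ℝ → ℝ) (t : ℝ) : ℝ := √t * ψ t

/-- `f₀(s) = ((Θ²)⁻¹(s))^{1/2}`, where `(Θ²)⁻¹` is the inverse function of `Θ²` on `[0, ∞)`.
For an index function `ψ`, the function `Θ²` is a bijection of `[0, ∞)`. -/
def fZero (ψ : ℝ → ℝ) (s : ℝ) : ℝ :=
  √(Function.invFunOn (fun t => Theta ψ t ^ 2) (Ici 0) s)

/-- `g²(t) = (φ/φ₀)²((Θ²)⁻¹(t))` with `φ₀(t) = √t`. -/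
def gSq (φ ψ : ℝ → ℝ) (t : ℝ) : ℝ := (φ (fZero ψ t ^ 2) / √(fZero ψ t ^ 2)) ^ 2

/-! ### Operators -/

section Operators

variable {X : Type*} [NormedAddCommGroup X] [InnerProductSpace ℝ X] [CompleteSpace X]

/-- Orthogonal projection onto `ker (G - μ I)`; it is zero unless `μ` is an eigenvalue of `G`. -/
def eigenProj (G : X →L[ℝ] X) (μ : ℝ) : X →L[ℝ] X :=
  (LinearMap.ker (G - μ • (1 : X →L[ℝ] X)).toLinearMap).starProjection

/-- Functional calculus `f(G) = ∑_μ f(μ) P_μ` of a compact self-adjoint operator `G`, with the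
spectral projections `P_μ`. The sum converges in operator norm if `f` is continuous with `f(0) = 0`,
and it is a finite sum if `X` has finite dimension. -/
def opFun (f : ℝ → ℝ) (G : X →L[ℝ] X) : X →L[ℝ] X := ∑' μ : ℝ, f μ • eigenProj G μ

/-- An orthonormal basis of `X`. -/
def someBasis (X : Type*) [NormedAddCommGroup X] [InnerProductSpace ℝ X] [CompleteSpace X] :
    HilbertBasis (exists_hilbertBasis ℝ X).choose ℝ X :=
  (exists_hilbertBasis ℝ X).choose_spec.choose

/-- Trace of a non-negative self-adjoint operator, with value in `[0, ∞]`. -/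
def opTrace (T : X →L[ℝ] X) : ℝ≥0∞ :=
  ∑' i, ENNReal.ofReal ⟪T (someBasis X i), someBasis X i⟫_ℝ

end Operators

/-- `f` is operator concave on `[0, a]`: it is a continuous non-negative function there, and
`f((G + G')/2) ≥ (f(G) + f(G'))/2` for all non-negative self-adjoint `G`, `G'` with spectra in
`[0, a]` on Euclidean spaces of every (finite) dimension. The order is the usual order of
self-adjoint operators. -/
def OperatorConcaveOn (f : ℝ → ℝ) (a : ℝ) : Prop :=
  ContinuousOn f (Icc 0 a) ∧ (∀ t ∈ Icc 0 a, 0 ≤ f t) ∧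
    ∀ (n : ℕ) (G G' : EuclideanSpace ℝ (Fin n) →L[ℝ] EuclideanSpace ℝ (Fin n)),
      G.IsPositive → G'.IsPositive → spectrum ℝ G ⊆ Icc 0 a → spectrum ℝ G' ⊆ Icc 0 a →
        (1 / 2 : ℝ) • (opFun f G + opFun f G') ≤ opFun f ((1 / 2 : ℝ) • (G + G'))

/-- Operator concavity of a function on `[0, ∞)`. -/
def OperatorConcave (f : ℝ → ℝ) : Prop := ∀ a, 0 < a → OperatorConcaveOn f a

section Model

variable {X Y : Type*} [NormedAddCommGroup X] [InnerProductSpace ℝ X] [CompleteSpace X]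
  [NormedAddCommGroup Y] [InnerProductSpace ℝ Y] [CompleteSpace Y]

/-- `T = Σ^{-1/2} K` as a bounded operator, that is, `Σ^{1/2} T = K` for the non-negative square
root `Σ^{1/2}` of the noise covariance `Σ`. -/
def IsWhitened (K : X →L[ℝ] Y) (Sig : Y →L[ℝ] Y) (T : X →L[ℝ] Y) : Prop :=
  ∃ R : Y →L[ℝ] Y, R.IsPositive ∧ R ∘L R = Sig ∧ R ∘L T = K

/-- `B = T C₀^{1/2}`. -/
def opB (T : X →L[ℝ] Y) (C₀ : X →L[ℝ] X) : X →L[ℝ] Y := T ∘L opFun Real.sqrt C₀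

/-- `H = B^* B`. -/
def opH (T : X →L[ℝ] Y) (C₀ : X →L[ℝ] X) : X →L[ℝ] X := (opB T C₀).adjoint ∘L opB T C₀

/-- The source set `{φ(C₀) v : ‖v‖ ≤ 1}`. -/
def sourceSet (φ : ℝ → ℝ) (C₀ : X →L[ℝ] X) : Set X := {x | ∃ v : X, ‖v‖ ≤ 1 ∧ x = opFun φ C₀ v}

/-- Link condition for `T = Σ^{-1/2} K` with the index function `ψ` and constants `m`, `M`. -/
structure LinkCondition (T : X →L[ℝ] Y) (C₀ : X →L[ℝ] X) (ψ : ℝ → ℝ) (m M : ℝ) : Prop where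
  index : IsIndexFun ψ
  m_pos : 0 < m
  m_le : m ≤ 1
  le_M : 1 ≤ M
  lower : ∀ x, m * ‖opFun ψ C₀ x‖ ≤ ‖T x‖
  upper : ∀ x, ‖T x‖ ≤ M * ‖opFun ψ C₀ x‖
  concave : OperatorConcave fun s => fZero ψ s ^ 2

/-- Regular case: `φ₀ ≺ φ ≺ Θ`, and `g²` is operator concave. -/
def RegularCase (φ ψ : ℝ → ℝ) : Prop :=
  Prec Real.sqrt φ ∧ Prec φ (Theta ψ) ∧ OperatorConcave (gSq φ ψ)

/-- Low-order case: `1 ≺ φ ≺ φ₀`, and `φ²` is operator concave. -/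
def LowOrderCase (φ : ℝ → ℝ) : Prop :=
  Prec (fun _ => 1) φ ∧ Prec φ Real.sqrt ∧ OperatorConcave fun t => φ t ^ 2

/-- Lifting condition
`m^u ‖Θ^u(C₀) x‖ ≤ ‖H^{u/2} x‖ ≤ M^u ‖Θ^u(C₀) x‖`. -/
def LiftingCondition (T : X →L[ℝ] Y) (C₀ : X →L[ℝ] X) (ψ : ℝ → ℝ) (m M u : ℝ) : Prop :=
  ∀ x, m ^ u * ‖opFun (fun t => Theta ψ t ^ u) C₀ x‖ ≤ ‖opFun (fun t => t ^ (u / 2)) (opH T C₀) x‖ ∧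
    ‖opFun (fun t => t ^ (u / 2)) (opH T C₀) x‖ ≤ M ^ u * ‖opFun (fun t => Theta ψ t ^ u) C₀ x‖

/-- The lifting condition with equality in its right-hand inequality. -/
def LiftingConditionEq (T : X →L[ℝ] Y) (C₀ : X →L[ℝ] X) (ψ : ℝ → ℝ) (m M u : ℝ) : Prop :=
  LiftingCondition T C₀ ψ m M u ∧
    ∀ x, ‖opFun (fun t => t ^ (u / 2)) (opH T C₀) x‖ = M ^ u * ‖opFun (fun t => Theta ψ t ^ u) C₀ x‖

/-- Conditions on the index functions in the high-order case: `φ/φ₀ ≺ Θ^u`, and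
`t ↦ g²(t^{1/u})` is operator concave. -/
def HighOrderIndex (φ ψ : ℝ → ℝ) (u : ℝ) : Prop :=
  Prec (fun t => φ t / √t) (fun t => Theta ψ t ^ u) ∧
    OperatorConcave fun t => gSq φ ψ (t ^ (1 / u))

/-- The quantity `φ²(f₀²(α)) + 2 δ² tr((αI + H)⁻¹ f₀²(H))`. -/
def spcBound (T : X →L[ℝ] Y) (C₀ : X →L[ℝ] X) (φ ψ : ℝ → ℝ) (α δ : ℝ) : ℝ≥0∞ :=
  ENNReal.ofReal (φ (fZero ψ α ^ 2) ^ 2) + 2 * ENNReal.ofReal (δ ^ 2) *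
    opTrace (Ring.inverse (α • (1 : X →L[ℝ] X) + opH T C₀) *
      opFun (fun t => fZero ψ t ^ 2) (opH T C₀))

/-! ### Bayesian model -/

/-- `μ` is the centred Gaussian measure with covariance operator `C`. -/
structure IsCentredGaussian [MeasurableSpace X] (μ : Measure X) (C : X →L[ℝ] X) : Prop where
  gaussian : IsGaussian μ
  mean : ∫ x, x ∂μ = 0
  cov : ∀ y z, ∫ x, ⟪y, x⟫_ℝ * ⟪z, x⟫_ℝ ∂μ = ⟪C y, z⟫_ℝ

/-- Gaussian white noise on `Y`, as a weak random element: a linear map `y ↦ W y = ⟨ξ, y⟩`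
into random variables with `W y ∼ N(0, ‖y‖²)`. -/
structure IsWhiteNoise {Ω : Type*} [MeasurableSpace Ω] (P : Measure Ω) (W : Y → Ω → ℝ) :
    Prop where
  measurable : ∀ y, Measurable (W y)
  law : ∀ y, P.map (W y) = gaussianReal 0 (‖y‖₊ ^ 2)
  add : ∀ y z, ∀ᵐ ω ∂P, W (y + z) ω = W y ω + W z ω
  smul : ∀ (c : ℝ) y, ∀ᵐ ω ∂P, W (c • y) ω = c * W y ω

variable {Ω : Type*} [MeasurableSpace Ω] [MeasurableSpace X]

/-- Distribution of the data `z^δ = T x + δ ξ` given `x`. A realization of the data is the family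
of the values `⟨z^δ, y⟩ = ⟨T x, y⟩ + δ ⟨ξ, y⟩`, `y ∈ Y`. -/
def dataKernel (T : X →L[ℝ] Y) (P : Measure Ω) (W : Y → Ω → ℝ) (δ : ℝ) : Kernel X (Y → ℝ) :=
  (Kernel.id ×ₖ Kernel.const X P).map fun p : X × Ω => fun y => ⟪T p.1, y⟫_ℝ + δ * W y p.2

/-- The prior `N(0, (δ²/α) C₀)`, obtained from `μ₀ = N(0, C₀)` by scaling. -/
def prior (μ₀ : Measure X) (α δ : ℝ) : Measure X := μ₀.map fun x => (δ / √α) • x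

variable [BorelSpace X] [SecondCountableTopology X]

/-- Squared posterior contraction
`SPC(α, δ) = 𝔼^{x*} 𝔼_α^{z^δ} ‖x* - x‖²`: the inner expectation is over the posterior given the
data `z`, the outer one over the data generated by `x*`. -/
def SPC (T : X →L[ℝ] Y) (P : Measure Ω) [IsProbabilityMeasure P] (W : Y → Ω → ℝ)
    (μ₀ : Measure X) [IsProbabilityMeasure μ₀] (xs : X) (α δ : ℝ) : ℝ≥0∞ :=
  haveI : IsFiniteMeasure (prior μ₀ α δ) := by unfold prior; infer_instance
  haveI : IsFiniteKernel (dataKernel T P W δ) := by unfold dataKernel; infer_instance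
  ∫⁻ z, ∫⁻ x, ENNReal.ofReal (‖xs - x‖ ^ 2) ∂(posterior (dataKernel T P W δ) (prior μ₀ α δ) z)
    ∂(dataKernel T P W δ xs)

end Model

end PosteriorContraction

end

open PosteriorContraction

/-! Write Q = (αI + H)⁻¹. Given the data z, the coordinate ⟨x, h⟩ is normal with mean z(y), y = B Q
C₀^{1/2} h, and with a variance that does not depend on z. Summed over an orthonormal basis (e_i),
the contraction therefore splits into the squared bias ‖(I - C₀^{1/2} Q B* T) x*‖², the posterior
variance, and the fluctuation of the posterior mean. With p = Q C₀^{1/2} e_i the last two contribute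
δ²(α‖p‖² + 2‖Bp‖²) ≤ 2δ²⟨p, C₀^{1/2} e_i⟩, which is where the factor 2 comes from
(`SpectralData.SPC_le`). Since a posterior is determined only up to null sets of the marginal law of
the data, a Cameron–Martin argument is needed to evaluate it under the law belonging to x*.

The link condition reads m² Θ²(C₀) ≤ H ≤ M² Θ²(C₀). Non-negative operator concave functions on [0,
∞) are operator monotone and satisfy Jensen's inequality for contractions
(`OperatorConcave.jensen`). As C₀ = f₀²(Θ²(C₀)), this gives m² C₀ ≤ f₀²(H) ≤ M² C₀; the left half
bounds the trace term.

On C₀^{1/2} w the bias operator acts as C₀^{1/2} α(αI + H)⁻¹ w. In the regular and high-order cases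
x* = C₀^{1/2} (φ/φ₀)(C₀) v, and both outer factors are dominated by functions of H. Functions of H
commute, so the bias is bounded by a supremum of scalar residuals φ(f₀²(s)) α/(α + m² s) or a
variant of it. In the low-order case φ/φ₀ is unbounded near 0, and Jensen's inequality for φ² with a
contraction built from f₀(H) and C₀^{-1/2} replaces the factorization (`SpectralData.bias_low`). -/

namespace PosteriorContraction

universe u

/-! ### Diagonal operators and their functional calculus. -/

section Diagonal

variable {X : Type*} [NormedAddCommGroup X] [InnerProductSpace ℝ X] {ι : Type*}

/-- `D` is diagonal in the orthonormal basis `e`, with eigenvalues `d`. -/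
def DiagOn (e : HilbertBasis ι ℝ X) (d : ι → ℝ) (D : X →L[ℝ] X) : Prop :=
  ∀ x i, ⟪e i, D x⟫_ℝ = d i * ⟪e i, x⟫_ℝ

theorem hilbertBasis_ext (e : HilbertBasis ι ℝ X) {x y : X}
    (h : ∀ i, ⟪e i, x⟫_ℝ = ⟪e i, y⟫_ℝ) : x = y := by
  apply e.repr.injective
  ext i
  simpa [e.repr_apply_apply] using h i

theorem hasSum_sq_inner (e : HilbertBasis ι ℝ X) (x : X) :
    HasSum (fun i => ⟪e i, x⟫_ℝ ^ 2) (‖x‖ ^ 2) := by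
  have h := e.hasSum_inner_mul_inner x x
  rw [real_inner_self_eq_norm_sq] at h
  simpa only [real_inner_comm x, ← sq] using h

namespace DiagOn

variable {e : HilbertBasis ι ℝ X} {d d' : ι → ℝ} {D D' : X →L[ℝ] X}

theorem apply_basis (h : DiagOn e d D) (i : ι) : D (e i) = d i • e i := by
  refine hilbertBasis_ext e fun j => ?_
  rw [h, inner_smul_right]
  rcases eq_or_ne j i with rfl | hne
  · rfl
  · simp [e.orthonormal.2 hne]

theorem of_apply_basis (h : ∀ i, D (e i) = d i • e i) : DiagOn e d D := by
  intro x i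
  have h1 : (innerSL ℝ (e i)).comp D = d i • innerSL ℝ (e i) := by
    refine ContinuousLinearMap.ext_on (s := Set.range e) ?_ ?_
    · exact Submodule.dense_iff_topologicalClosure_eq_top.2 e.dense_span
    · rintro _ ⟨j, rfl⟩
      simp only [ContinuousLinearMap.comp_apply, innerSL_apply_apply, h, inner_smul_right,
        smul_apply, smul_eq_mul]
      rcases eq_or_ne i j with rfl | hne
      · rfl
      · simp [e.orthonormal.2 hne]
  simpa using congrArg (fun L : X →L[ℝ] ℝ => L x) h1

theorem eq (h : DiagOn e d D) (h' : DiagOn e d D') : D = D' := by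
  ext x
  exact hilbertBasis_ext e fun i => by rw [h, h']

theorem congr (h : DiagOn e d D) (hd : ∀ i, d i = d' i) : DiagOn e d' D := fun x i => by
  rw [h, hd]

theorem add (h : DiagOn e d D) (h' : DiagOn e d' D') :
    DiagOn e (fun i => d i + d' i) (D + D') := fun x i => by
  rw [add_apply, inner_add_right, h, h', add_mul]

theorem smul (h : DiagOn e d D) (c : ℝ) : DiagOn e (fun i => c * d i) (c • D) := fun x i => by
  rw [smul_apply, inner_smul_right, h, mul_assoc]

theorem one : DiagOn e (fun _ => 1) (1 : X →L[ℝ] X) := fun x i => by simp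

theorem mul (h : DiagOn e d D) (h' : DiagOn e d' D') :
    DiagOn e (fun i => d i * d' i) (D * D') := fun x i => by
  rw [_root_.mul_apply_eq_comp, h, h', mul_assoc]

theorem hasSum_inner (h : DiagOn e d D) (x y : X) :
    HasSum (fun i => d i * (⟪e i, x⟫_ℝ * ⟪e i, y⟫_ℝ)) ⟪D x, y⟫_ℝ := by
  have := e.hasSum_inner_mul_inner (D x) y
  simpa only [← real_inner_comm (D x), h x, mul_assoc] using this

theorem inner_comm (h : DiagOn e d D) (x y : X) : ⟪D x, y⟫_ℝ = ⟪x, D y⟫_ℝ := by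
  rw [real_inner_comm (D y) x]
  refine (h.hasSum_inner x y).unique ?_
  simpa only [mul_comm ⟪e _, y⟫_ℝ] using h.hasSum_inner y x

theorem hasSum_quad (h : DiagOn e d D) (x : X) :
    HasSum (fun i => d i * ⟪e i, x⟫_ℝ ^ 2) ⟪D x, x⟫_ℝ := by
  simpa only [sq] using h.hasSum_inner x x

theorem hasSum_norm_sq (h : DiagOn e d D) (x : X) :
    HasSum (fun i => d i ^ 2 * ⟪e i, x⟫_ℝ ^ 2) (‖D x‖ ^ 2) := by
  have := hasSum_sq_inner e (D x)
  simpa only [h x, mul_pow] using this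

theorem norm_le (h : DiagOn e d D) {c : ℝ} (hc : 0 ≤ c) (hd : ∀ i, |d i| ≤ c) : ‖D‖ ≤ c := by
  refine ContinuousLinearMap.opNorm_le_bound _ hc fun x => ?_
  refine le_of_sq_le_sq ?_ (by positivity)
  rw [mul_pow]
  refine hasSum_le (fun i => ?_) (h.hasSum_norm_sq x) ((hasSum_sq_inner e x).mul_left (c ^ 2))
  gcongr ?_ * _
  exact sq_le_sq' (by linarith [abs_le.1 (hd i)]) (abs_le.1 (hd i)).2

theorem norm_apply_le (h : DiagOn e d D) {c : ℝ} (hc : 0 ≤ c) (hd : ∀ i, |d i| ≤ c) (x : X) :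
    ‖D x‖ ≤ c * ‖x‖ :=
  D.le_of_opNorm_le (h.norm_le hc hd) x

theorem exists_of_bounded (e : HilbertBasis ι ℝ X) (d : ι → ℝ) {c : ℝ} (hd : ∀ i, |d i| ≤ c) :
    ∃ D : X →L[ℝ] X, DiagOn e d D := by
  have hsq : ∀ (y : X) i, ‖d i * e.repr y i‖ ^ 2 ≤ c ^ 2 * ⟪e i, y⟫_ℝ ^ 2 := fun y i => by
    rw [e.repr_apply_apply, norm_mul, mul_pow, Real.norm_eq_abs, Real.norm_eq_abs, sq_abs ⟪e i, y⟫_ℝ]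
    gcongr
    exact hd i
  have hmem : ∀ y : X, Memℓp (fun i => d i * e.repr y i) 2 := fun y => by
    refine (memℓp_gen_iff (by norm_num)).2 ?_
    simp only [ENNReal.toReal_ofNat, Real.rpow_ofNat]
    exact .of_nonneg_of_le (fun i => by positivity) (hsq y) ((hasSum_sq_inner e y).summable.mul_left _)
  let L : X →ₗ[ℝ] X :=
    { toFun := fun y => e.repr.symm ⟨_, hmem y⟩
      map_add' := fun y z => by
        rw [← map_add]
        congr 1
        simp only [map_add]
        ext i
        exact mul_add (d i) (e.repr y i) (e.repr z i)
      map_smul' := fun r y => by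
        rw [← map_smul]
        congr 1
        ext i
        simp only [map_smul, lp.coeFn_smul, Pi.smul_apply, smul_eq_mul, RingHom.id_apply]
        ring }
  have hL : ∀ y i, ⟪e i, L y⟫_ℝ = d i * ⟪e i, y⟫_ℝ := fun y i => by
    rw [← e.repr_apply_apply, ← e.repr_apply_apply]
    simp [L]
  refine ⟨L.mkContinuous |c| fun y => ?_, fun y i => hL y i⟩
  refine le_of_sq_le_sq ?_ (by positivity)
  rw [mul_pow, sq_abs]
  refine hasSum_le (fun i => ?_) (hasSum_sq_inner e (L y)) ((hasSum_sq_inner e y).mul_left (c ^ 2))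
  have := hsq y i
  rwa [e.repr_apply_apply, ← hL, Real.norm_eq_abs, sq_abs] at this

end DiagOn

variable {e : HilbertBasis ι ℝ X} {a : ι → ℝ} {G : X →L[ℝ] X}

/-- The vectors `a i • e i` with `a i ≥ η` lie in the image of the unit ball at mutual distance at
least η, so distinct indices need distinct points of a finite η/2-net. -/
theorem DiagOn.finite_le (h : DiagOn e a G) (hG : IsCompactOperator G) {η : ℝ} (hη : 0 < η) :
    {i | η ≤ a i}.Finite := by
  have hK := (hG.isCompact_closure_image_closedBall 1).totallyBounded
  obtain ⟨t, ht, hcov⟩ := Metric.totallyBounded_iff.1 hK (η / 2) (half_pos hη)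
  have hmem : ∀ i, ∃ y ∈ t, dist (a i • e i) y < η / 2 := fun i => by
    have : a i • e i ∈ closure (G '' Metric.closedBall 0 1) :=
      subset_closure ⟨e i, by simp [e.orthonormal.1 i], h.apply_basis i⟩
    simpa using hcov this
  choose y hyt hy using hmem
  refine Set.Finite.of_finite_image (f := y) (ht.subset ?_) fun i hi j hj hij => ?_
  · rintro _ ⟨i, -, rfl⟩
    exact hyt i
  · by_contra hne
    have h1 : dist (a i • e i) (a j • e j) < η := by
      have := hy j
      rw [← hij, dist_comm] at this
      linarith [hy i, dist_triangle (a i • e i) (y i) (a j • e j)]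
    have h2 : η ≤ dist (a i • e i) (a j • e j) := by
      rw [dist_eq_norm]
      have h3 := abs_real_inner_le_norm (e i) (a i • e i - a j • e j)
      rw [e.orthonormal.1 i, one_mul, inner_sub_right, inner_smul_right, inner_smul_right,
        e.orthonormal.2 hne, real_inner_self_eq_norm_sq, e.orthonormal.1 i] at h3
      have h4 : η ≤ a i := hi
      linarith [le_abs_self (a i * 1 ^ 2 - a j * 0)]
    linarith

variable [CompleteSpace X]

theorem DiagOn.eigenProj (h : DiagOn e a G) (μ : ℝ) :
    DiagOn e (fun i => if a i = μ then 1 else 0) (eigenProj G μ) := by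
  refine .of_apply_basis fun i => ?_
  unfold PosteriorContraction.eigenProj
  split_ifs with hi
  · rw [one_smul, Submodule.starProjection_eq_self_iff]
    simp [h.apply_basis, hi]
  · rw [zero_smul, Submodule.starProjection_apply_eq_zero_iff, Submodule.mem_orthogonal']
    intro x hx
    have hx' : G x = μ • x := by simpa [sub_eq_zero] using hx
    have := h x i
    rw [hx', inner_smul_right] at this
    have h0 : (μ - a i) * ⟪e i, x⟫_ℝ = 0 := by linarith
    exact (mul_eq_zero.1 h0).resolve_left fun h1 => hi (by linarith)

/-- The functional `A ↦ ⟪e i, A x⟫` is continuous in operator norm, and only the term with `μ = a i`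
survives it. -/
theorem DiagOn.opFun_of_summable (h : DiagOn e a G) {f : ℝ → ℝ}
    (hs : Summable fun μ => f μ • PosteriorContraction.eigenProj G μ) :
    DiagOn e (fun i => f (a i)) (opFun f G) := by
  intro x i
  let L : (X →L[ℝ] X) →L[ℝ] ℝ := (innerSL ℝ (e i)).comp (ContinuousLinearMap.apply ℝ X x)
  have h1 : HasSum (fun μ => L (f μ • PosteriorContraction.eigenProj G μ)) (L (opFun f G)) :=
    hs.hasSum.mapL L
  have h2 : HasSum (fun μ => L (f μ • PosteriorContraction.eigenProj G μ))
      (L (f (a i) • PosteriorContraction.eigenProj G (a i))) := by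
    refine hasSum_single _ fun μ hμ => ?_
    simp [L, (h.eigenProj μ) x i, hμ.symm]
  have h3 := h1.unique h2
  simpa [L, (h.eigenProj (a i)) x i, inner_smul_right] using h3

theorem DiagOn.opFun_of_finite [Finite ι] (h : DiagOn e a G) (f : ℝ → ℝ) :
    DiagOn e (fun i => f (a i)) (opFun f G) := by
  refine h.opFun_of_summable (summable_of_hasFiniteSupport ?_)
  refine (Set.finite_range a).subset fun μ hμ => ?_
  by_contra hne
  refine hμ ?_
  have : DiagOn e (fun _ => 0) (PosteriorContraction.eigenProj G μ) :=
    (h.eigenProj μ).congr fun i => if_neg fun hi => hne ⟨i, hi⟩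
  have h0 : PosteriorContraction.eigenProj G μ = 0 := this.eq fun x i => by simp
  simp [h0]

theorem DiagOn.sum_eigenProj (h : DiagOn e a G) (f : ℝ → ℝ) (s : Finset ℝ) :
    DiagOn e (fun i => if a i ∈ s then f (a i) else 0)
      (∑ μ ∈ s, f μ • PosteriorContraction.eigenProj G μ) := by
  intro x i
  simp only [sum_apply, smul_apply, inner_sum, inner_smul_right,
    (h.eigenProj _) x i]
  rw [Finset.sum_congr rfl (g := fun μ => if a i = μ then f (a i) * ⟪e i, x⟫_ℝ else 0)]
  · simp
  · intro μ _
    split_ifs with hi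
    · simp [hi]
    · simp

/-- Cauchy criterion in operator norm: once the finitely many eigenvalues above η are excluded,
every finite partial sum is diagonal with entries at most ε/2, because `f` is small near `0`. -/
theorem DiagOn.opFun (h : DiagOn e a G) (ha : ∀ i, 0 ≤ a i) (hfin : ∀ η > 0, {i | η ≤ a i}.Finite)
    {f : ℝ → ℝ} (hf : ContinuousWithinAt f (Ici 0) 0) (hf0 : f 0 = 0) :
    DiagOn e (fun i => f (a i)) (opFun f G) := by
  refine h.opFun_of_summable (summable_iff_vanishing_norm.2 fun ε hε => ?_)
  obtain ⟨η, hη, hηf⟩ := Metric.continuousWithinAt_iff.1 hf (ε / 2) (half_pos hε)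
  refine ⟨((hfin η hη).image a).toFinset, fun t ht => ?_⟩
  refine ((h.sum_eigenProj f t).norm_le (half_pos hε).le fun i => ?_).trans_lt (half_lt_self hε)
  split_ifs with hi
  · have h1 : a i < η := by
      by_contra hlt
      exact Finset.disjoint_left.1 ht hi (by simpa using ⟨i, not_lt.1 hlt, rfl⟩)
    have := hηf (ha i) (by simpa [abs_of_nonneg (ha i)] using h1)
    rw [hf0, dist_zero_right, Real.norm_eq_abs] at this
    exact this.le
  · simpa using (half_pos hε).le

end Diagonal

/-! ### Spectral theorem for compact operators. -/

section Spectral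

variable {X : Type u} [NormedAddCommGroup X] [InnerProductSpace ℝ X] [CompleteSpace X]

/-- Spectral theorem: a compact symmetric operator is diagonal in some orthonormal basis. -/
theorem exists_diagOn {G : X →L[ℝ] X} (hG : IsCompactOperator G)
    (hG' : G.IsSymmetric) :
    ∃ (ι : Type u) (e : HilbertBasis ι ℝ X) (a : ι → ℝ), DiagOn e a G := by
  let E : ℝ → Submodule ℝ X := fun μ => Module.End.eigenspace (G : Module.End ℝ X) μ
  have hE : ∀ μ (v : E μ), G v = μ • (v : X) := fun μ v => Module.End.mem_eigenspace_iff.1 v.2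
  have hcl : ∀ μ, CompleteSpace (E μ) := fun μ => by
    refine IsClosed.completeSpace_coe (hs := ?_)
    have : (E μ : Set X) = {x | G x = μ • x} := by
      ext x
      exact Module.End.mem_eigenspace_iff
    rw [this]
    exact isClosed_eq G.continuous (continuous_const_smul μ)
  choose w b hb using fun μ => exists_hilbertBasis ℝ (E μ)
  have hfam := LinearMap.IsSymmetric.orthogonalFamily_eigenspaces hG'
  have hon := hfam.orthonormal_sigma_orthonormal (v_family := fun μ => b μ)
    fun μ => (b μ).orthonormal
  have hbot := ContinuousLinearMap.orthogonalComplement_iSup_eigenspaces_eq_bot hG hG'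
  refine ⟨Σ μ, w μ, HilbertBasis.mkOfOrthogonalEqBot hon ?_, fun s => s.1, ?_⟩
  -- A vector orthogonal to all chosen eigenvectors is orthogonal to every eigenspace, hence zero.
  · rw [eq_bot_iff, ← hbot]
    intro x hx
    rw [Submodule.mem_orthogonal'] at hx ⊢
    intro u hu
    induction hu using Submodule.iSup_induction' with
    | mem μ v hv =>
      have h1 : (innerSL ℝ x).comp (E μ).subtypeL = 0 := by
        refine ContinuousLinearMap.ext_on (s := Set.range (b μ)) ?_ ?_
        · exact Submodule.dense_iff_topologicalClosure_eq_top.2 (b μ).dense_span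
        · rintro _ ⟨i, rfl⟩
          exact hx _ (Submodule.subset_span ⟨⟨μ, i⟩, rfl⟩)
      exact congrArg (fun L : E μ →L[ℝ] ℝ => L ⟨v, hv⟩) h1
    | zero => simp
    | add u v _ _ hu hv => rw [inner_add_right, hu, hv, add_zero]
  · refine .of_apply_basis fun s => ?_
    simpa using hE s.1 (b s.1 s.2)

theorem exists_diagOn_of_isPositive {G : X →L[ℝ] X} (hG : IsCompactOperator G)
    (hG' : G.IsPositive) :
    ∃ (ι : Type u) (e : HilbertBasis ι ℝ X) (a : ι → ℝ), DiagOn e a G ∧ (∀ i, 0 ≤ a i) ∧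
      ∀ η > 0, {i | η ≤ a i}.Finite := by
  obtain ⟨ι, e, a, h⟩ := exists_diagOn hG hG'.isSymmetric
  refine ⟨ι, e, a, h, fun i => ?_, fun η hη => h.finite_le hG hη⟩
  have := hG'.inner_nonneg_left (e i)
  rw [h.apply_basis, inner_smul_left, real_inner_self_eq_norm_sq, e.orthonormal.1 i] at this
  simpa using this

end Spectral

end PosteriorContraction
namespace PosteriorContraction

universe u

/-! ### Positive operators: eigenbases in finite dimension, location of the spectrum. -/

section FiniteDimensional

variable {E : Type u} [NormedAddCommGroup E] [InnerProductSpace ℝ E] [FiniteDimensional ℝ E]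

theorem exists_finite_diagOn {G : E →L[ℝ] E} (hG : G.IsPositive) :
    ∃ (ι : Type u) (_ : Fintype ι) (e : HilbertBasis ι ℝ E) (a : ι → ℝ),
      DiagOn e a G ∧ ∀ i, 0 ≤ a i := by
  have := FiniteDimensional.complete ℝ E
  have := FiniteDimensional.proper ℝ E
  obtain ⟨ι, e, a, h, ha, -⟩ :=
    exists_diagOn_of_isPositive (isCompactOperator_of_locallyCompactSpace_dom G) hG
  have := e.orthonormal.linearIndependent.finite
  exact ⟨ι, Fintype.ofFinite ι, e, a, h, ha⟩

theorem DiagOn.isPositive {X : Type*} [NormedAddCommGroup X] [InnerProductSpace ℝ X]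
    {ι : Type*} {e : HilbertBasis ι ℝ X} {d : ι → ℝ} {D : X →L[ℝ] X} (h : DiagOn e d D)
    (hd : ∀ i, 0 ≤ d i) : D.IsPositive := by
  refine (ContinuousLinearMap.isPositive_iff D).2 ⟨fun x y => h.inner_comm x y, fun x => ?_⟩
  exact (h.hasSum_quad x).nonneg fun i => mul_nonneg (hd i) (sq_nonneg _)

/-- For `μ < 0` the form of `G - μ` is at least `-μ ‖x‖²`, so `G - μ` is invertible. The factor
`‖1‖` avoids assuming a nontrivial space. -/
theorem spectrum_subset_of_isPositive {X : Type*} [NormedAddCommGroup X] [InnerProductSpace ℝ X]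
    [CompleteSpace X] {G : X →L[ℝ] X} (hG : G.IsPositive) {c : ℝ}
    (hc : ‖G‖ * ‖(1 : X →L[ℝ] X)‖ ≤ c) : spectrum ℝ G ⊆ Icc 0 c := by
  intro μ hμ
  refine ⟨?_, (le_abs_self μ).trans ((spectrum.norm_le_norm_mul_of_mem hμ).trans hc)⟩
  by_contra! hneg
  refine hμ (IsUnit.sub_iff.1 ?_)
  refine ContinuousLinearMap.isUnit_of_forall_le_norm_inner_map _ (c := (-μ).toNNReal)
    (by simpa using hneg) fun x => ?_
  have h1 := hG.inner_nonneg_left x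
  have h2 : ⟪(G - algebraMap ℝ (X →L[ℝ] X) μ) x, x⟫_ℝ = ⟪G x, x⟫_ℝ - μ * ‖x‖ ^ 2 := by
    simp [Algebra.algebraMap_eq_smul_one, inner_sub_left, inner_smul_left]
  rw [h2]
  refine le_trans ?_ (le_abs_self _)
  rw [Real.coe_toNNReal _ (by linarith)]
  linarith

end FiniteDimensional

/-! ### Operator concavity implies operator monotonicity. -/

section Monotone

variable {f : ℝ → ℝ} {n : ℕ}

local notation "𝔼" => EuclideanSpace ℝ (Fin n)

theorem OperatorConcave.nonneg (hf : OperatorConcave f) {t : ℝ} (ht : 0 ≤ t) : 0 ≤ f t :=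
  (hf (t + 1) (by linarith)).2.1 t ⟨ht, by linarith⟩

theorem OperatorConcave.continuousOn (hf : OperatorConcave f) : ContinuousOn f (Ici 0) := by
  intro t ht
  have h1 := (hf (t + 1) (by linarith [mem_Ici.1 ht])).1 t ⟨ht, by linarith⟩
  refine h1.mono_of_mem_nhdsWithin ?_
  rw [← Ici_inter_Iic, inter_comm]
  exact Filter.inter_mem (mem_nhdsWithin_of_mem_nhds (Iic_mem_nhds (by linarith)))
    self_mem_nhdsWithin

theorem OperatorConcave.opFun_isPositive (hf : OperatorConcave f) {G : 𝔼 →L[ℝ] 𝔼}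
    (hG : G.IsPositive) : (opFun f G).IsPositive := by
  obtain ⟨ι, _, e, a, h, ha⟩ := exists_finite_diagOn hG
  exact (h.opFun_of_finite f).isPositive fun i => hf.nonneg (ha i)

theorem OperatorConcave.midpoint (hf : OperatorConcave f) {G G' : 𝔼 →L[ℝ] 𝔼}
    (hG : G.IsPositive) (hG' : G'.IsPositive) :
    (1 / 2 : ℝ) • (opFun f G + opFun f G') ≤ opFun f ((1 / 2 : ℝ) • (G + G')) := by
  set c := ‖G‖ * ‖(1 : 𝔼 →L[ℝ] 𝔼)‖ + ‖G'‖ * ‖(1 : 𝔼 →L[ℝ] 𝔼)‖ + 1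
  refine (hf c (by positivity)).2.2 n G G' hG hG' ?_ ?_
  · refine spectrum_subset_of_isPositive hG ?_
    have : 0 ≤ ‖G'‖ * ‖(1 : 𝔼 →L[ℝ] 𝔼)‖ := by positivity
    linarith
  · refine spectrum_subset_of_isPositive hG' ?_
    have : 0 ≤ ‖G‖ * ‖(1 : 𝔼 →L[ℝ] 𝔼)‖ := by positivity
    linarith

/-- Only midpoints are available, so they are iterated along the dyadic weights `1 - 2⁻ᵏ`. The
contribution of `f(C)` is discarded because `f ≥ 0`. -/
theorem OperatorConcave.smul_opFun_le (hf : OperatorConcave f) {T C : 𝔼 →L[ℝ] 𝔼}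
    (hT : T.IsPositive) (hC : C.IsPositive) (k : ℕ) :
    (1 - (1 / 2 : ℝ) ^ k) • opFun f T ≤
      opFun f ((1 - (1 / 2 : ℝ) ^ k) • T + ((1 / 2 : ℝ) ^ k) • C) := by
  induction k with
  | zero =>
    have h0 : (1 - (1 / 2 : ℝ) ^ 0) • T + ((1 / 2 : ℝ) ^ 0) • C = C := by module
    rw [h0, pow_zero, sub_self, zero_smul]
    exact (ContinuousLinearMap.nonneg_iff_isPositive _).2 (hf.opFun_isPositive hC)
  | succ k ih =>
    have hk : (0 : ℝ) ≤ 1 - (1 / 2) ^ k := sub_nonneg.2 (pow_le_one₀ (by norm_num) (by norm_num))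
    set D := (1 - (1 / 2 : ℝ) ^ k) • T + ((1 / 2 : ℝ) ^ k) • C
    have hD : D.IsPositive := (hT.smul_of_nonneg hk).add (hC.smul_of_nonneg (by positivity))
    have h1 := hf.midpoint hT hD
    have h2 : (1 - (1 / 2 : ℝ) ^ (k + 1)) • T + ((1 / 2 : ℝ) ^ (k + 1)) • C =
        (1 / 2 : ℝ) • (T + D) := by
      simp only [D]
      module
    rw [h2]
    refine le_trans ?_ h1
    rw [ContinuousLinearMap.le_def] at ih ⊢
    convert! ih.smul_of_nonneg (c := (1 / 2 : ℝ)) (by norm_num) using 1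
    module

/-- A non-negative operator concave function on `[0, ∞)` is operator monotone. -/
theorem OperatorConcave.opFun_mono (hf : OperatorConcave f) {A B : 𝔼 →L[ℝ] 𝔼}
    (hA : A.IsPositive) (hB : B.IsPositive) (hAB : A ≤ B) (x : 𝔼) :
    ⟪opFun f A x, x⟫_ℝ ≤ ⟪opFun f B x, x⟫_ℝ := by
  obtain ⟨ι, _, e, b, h, hb⟩ := exists_finite_diagOn hB
  have hl : ∀ k : ℕ, (0 : ℝ) ≤ 1 - (1 / 2) ^ k := fun k =>
    sub_nonneg.2 (pow_le_one₀ (by norm_num) (by norm_num))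
  have hlim : Filter.Tendsto (fun k : ℕ => (1 - (1 / 2 : ℝ) ^ k)) Filter.atTop (nhds 1) := by
    simpa using (tendsto_pow_atTop_nhds_zero_of_lt_one (r := (1 / 2 : ℝ)) (by norm_num)
      (by norm_num)).const_sub 1
  have hk : ∀ k : ℕ, (1 - (1 / 2 : ℝ) ^ k) * ⟪opFun f A x, x⟫_ℝ ≤
      ∑ i, f ((1 - (1 / 2 : ℝ) ^ k) * b i) * ⟪e i, x⟫_ℝ ^ 2 := fun k => by
    -- With `C = (1 - 2⁻ᵏ) 2ᵏ (B - A)`, the operator `(1 - 2⁻ᵏ) B` is the combination of `A` and `C`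
    -- with weights `1 - 2⁻ᵏ` and `2⁻ᵏ`. The remaining factor disappears as `k → ∞` by continuity of
    -- `f`.
    have hC : (((1 - (1 / 2 : ℝ) ^ k) * 2 ^ k) • (B - A)).IsPositive :=
      ContinuousLinearMap.IsPositive.smul_of_nonneg hAB (mul_nonneg (hl k) (by positivity))
    have h1 := (hf.smul_opFun_le hA hC k)
    have h2 : (1 - (1 / 2 : ℝ) ^ k) • A + ((1 / 2 : ℝ) ^ k) •
        (((1 - (1 / 2 : ℝ) ^ k) * 2 ^ k) • (B - A)) = (1 - (1 / 2 : ℝ) ^ k) • B := by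
      have h3 : ((1 / 2 : ℝ) ^ k) * ((1 - (1 / 2 : ℝ) ^ k) * 2 ^ k) = 1 - (1 / 2 : ℝ) ^ k := by
        rw [mul_comm (1 - _) _, ← mul_assoc, ← mul_pow]
        norm_num
      rw [smul_smul, h3]
      module
    rw [h2] at h1
    have h4 := ContinuousLinearMap.IsPositive.inner_nonneg_left h1 x
    rw [sub_apply, inner_sub_left, smul_apply, real_inner_smul_left,
      ← (((h.smul _).opFun_of_finite f).hasSum_quad x).unique (hasSum_fintype _)] at *
    linarith
  have hl' := hlim.mul_const ⟪opFun f A x, x⟫_ℝ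
  rw [one_mul] at hl'
  refine le_of_tendsto_of_tendsto' hl' ?_ hk
  rw [((h.opFun_of_finite f).hasSum_quad x).unique (hasSum_fintype _)]
  refine tendsto_finsetSum _ fun i _ => Filter.Tendsto.mul_const _ ?_
  have hcont := hf.continuousOn (b i) (hb i)
  refine hcont.tendsto.comp (tendsto_nhdsWithin_iff.2 ⟨?_, ?_⟩)
  · simpa using hlim.mul_const (b i)
  · exact Filter.Eventually.of_forall fun k => mul_nonneg (hl k) (hb i)

end Monotone

end PosteriorContraction
namespace PosteriorContraction

/-! ### Jensen's operator inequality in finite dimension. -/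

section Jensen

variable {f : ℝ → ℝ} {ι κ : Type*} [Fintype ι] [Fintype κ]

/-- A contraction is the first component of an isometry. -/
theorem exists_complement {F : Type*} [NormedAddCommGroup F] [InnerProductSpace ℝ F]
    [FiniteDimensional ℝ F] {F' : Type*} [NormedAddCommGroup F'] [InnerProductSpace ℝ F']
    [CompleteSpace F'] (Z : F →L[ℝ] F') (hZ : ∀ x, ‖Z x‖ ≤ ‖x‖) :
    ∃ Y : F →L[ℝ] F, ∀ x, ‖Y x‖ ^ 2 = ‖x‖ ^ 2 - ‖Z x‖ ^ 2 := by
  have := FiniteDimensional.complete ℝ F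
  set D : F →L[ℝ] F := 1 - Z.adjoint ∘L Z with hD
  have hquad : ∀ x, ⟪D x, x⟫_ℝ = ‖x‖ ^ 2 - ‖Z x‖ ^ 2 := fun x => by
    simp [hD, inner_sub_left, ContinuousLinearMap.adjoint_inner_left]
  have hpos : D.IsPositive := by
    refine (ContinuousLinearMap.isPositive_iff D).2 ⟨fun x y => ?_, fun x => ?_⟩
    · simp [hD, inner_sub_left, inner_sub_right, ContinuousLinearMap.adjoint_inner_left,
        ContinuousLinearMap.adjoint_inner_right]
    · rw [hquad]
      have := hZ x
      have := norm_nonneg (Z x)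
      nlinarith
  obtain ⟨ι', _, e, d, h, hd⟩ := exists_finite_diagOn hpos
  -- `Y = (I - Z* Z)^{1/2}`, built in an eigenbasis.
  obtain ⟨Y, hY⟩ := DiagOn.exists_of_bounded e (fun i => √(d i)) (c := ∑ i, √(d i)) fun i => by
    rw [abs_of_nonneg (Real.sqrt_nonneg _)]
    exact Finset.single_le_sum (f := fun i => √(d i)) (fun _ _ => Real.sqrt_nonneg _)
      (Finset.mem_univ i)
  refine ⟨Y, fun x => ?_⟩
  rw [← hquad]
  refine (hY.hasSum_norm_sq x).unique ?_
  simpa only [Real.sq_sqrt (hd _)] using h.hasSum_quad x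

theorem exists_diagOn_orthonormalBasis {E : Type*} [NormedAddCommGroup E] [InnerProductSpace ℝ E]
    [CompleteSpace E] (b : OrthonormalBasis ι ℝ E) (d : ι → ℝ) :
    ∃ D : E →L[ℝ] E, DiagOn b.toHilbertBasis d D :=
  DiagOn.exists_of_bounded _ d (c := ∑ i, |d i|) fun i =>
    Finset.single_le_sum (f := fun i => |d i|) (fun _ _ => abs_nonneg _) (Finset.mem_univ i)

theorem DiagOn.quad_eq_sum {E : Type*} [NormedAddCommGroup E] [InnerProductSpace ℝ E]
    [CompleteSpace E] {b : OrthonormalBasis ι ℝ E} {d : ι → ℝ} {D : E →L[ℝ] E}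
    (h : DiagOn b.toHilbertBasis d D) (x : E) : ⟪D x, x⟫_ℝ = ∑ i, d i * ⟪b i, x⟫_ℝ ^ 2 := by
  simpa using (h.hasSum_quad x).unique (hasSum_fintype _)

/-- An isometry `J` and an adapted orthonormal basis of the orthogonal complement of its range. -/
theorem exists_adapted_basis {E : Type*} [NormedAddCommGroup E] [InnerProductSpace ℝ E]
    [FiniteDimensional ℝ E] (J : EuclideanSpace ℝ κ →ₗᵢ[ℝ] E)
    (hcard : Module.finrank ℝ E = Fintype.card (ι ⊕ κ)) :
    ∃ β : OrthonormalBasis (ι ⊕ κ) ℝ E,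
      ∀ j, β (Sum.inr j) = J (EuclideanSpace.basisFun κ ℝ j) := by
  classical
  let v : ι ⊕ κ → E := Sum.elim 0 fun j => J (EuclideanSpace.basisFun κ ℝ j)
  have h1 : Orthonormal ℝ fun j => J (EuclideanSpace.basisFun κ ℝ j) :=
    (EuclideanSpace.basisFun κ ℝ).orthonormal.comp_linearIsometry J
  have hv : Orthonormal ℝ ((range (Sum.inr : κ → ι ⊕ κ)).domRestrict v) := by
    constructor
    · rintro ⟨_, j, rfl⟩
      exact h1.1 j
    · rintro ⟨_, j, rfl⟩ ⟨_, k, rfl⟩ hjk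
      exact h1.2 fun hne => hjk (by simp [hne])
  obtain ⟨β, hβ⟩ := hv.exists_orthonormalBasis_extension_of_card_eq hcard
  exact ⟨β, fun j => hβ _ ⟨j, rfl⟩⟩

/-- These are the components of `z` in `K` and `Kᗮ`, written with the reflection because the
midpoint inequality will average an operator with its reflected copy. -/
theorem half_reflection {E : Type*} [NormedAddCommGroup E] [InnerProductSpace ℝ E]
    (K : Submodule ℝ E) [K.HasOrthogonalProjection] (z : E) :
    (1 / 2 : ℝ) • (z + K.reflection z) ∈ K ∧ (1 / 2 : ℝ) • (z - K.reflection z) ∈ Kᗮ := by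
  rw [Submodule.reflection_apply]
  constructor
  · convert! K.starProjection_apply_mem z using 1
    module
  · convert! K.sub_starProjection_mem_orthogonal z using 1
    module

/-- Compression of `f(A)` by an isometry. -/
theorem OperatorConcave.compression (hf : OperatorConcave f) {n : ℕ}
    (J : EuclideanSpace ℝ κ →ₗᵢ[ℝ] EuclideanSpace ℝ (Fin n))
    (hcard : n = Fintype.card (ι ⊕ κ))
    {ε : OrthonormalBasis (ι ⊕ κ) ℝ (EuclideanSpace ℝ (Fin n))} {a : ι ⊕ κ → ℝ}
    (ha : ∀ i, 0 ≤ a i) {A : EuclideanSpace ℝ (Fin n) →L[ℝ] EuclideanSpace ℝ (Fin n)}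
    (hA : DiagOn ε.toHilbertBasis a A) {b : κ → ℝ} (hb : ∀ j, 0 ≤ b j)
    (h : ∀ y, ⟪A (J y), J y⟫_ℝ ≤ ∑ j, b j * y j ^ 2) (x : EuclideanSpace ℝ κ) :
    ⟪opFun f A (J x), J x⟫_ℝ ≤ ∑ j, f (b j) * x j ^ 2 := by
  obtain ⟨β, hβr⟩ := exists_adapted_basis (ι := ι) J (by simpa using hcard)
  have hβJ : ∀ y j, ⟪β (Sum.inr j), J y⟫_ℝ = y j := fun y j => by
    rw [hβr, J.inner_map_map, EuclideanSpace.basisFun_inner]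
  have hsum : ∀ z, ∑ i, ⟪β (Sum.inl i), z⟫_ℝ ^ 2 + ∑ j, ⟪β (Sum.inr j), z⟫_ℝ ^ 2 = ‖z‖ ^ 2 :=
    fun z => by
      rw [← β.sum_sq_norm_inner_right z, Fintype.sum_sum_type]
      simp
  have hβJl : ∀ y i, ⟪β (Sum.inl i), J y⟫_ℝ = 0 := fun y i => by
    have h1 := hsum (J y)
    simp only [hβJ, J.norm_map, EuclideanSpace.norm_sq_eq, Real.norm_eq_abs, sq_abs] at h1
    have h2 : ∑ i, ⟪β (Sum.inl i), J y⟫_ℝ ^ 2 = 0 := by linarith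
    exact pow_eq_zero_iff two_ne_zero |>.1
      ((Finset.sum_eq_zero_iff_of_nonneg fun i _ => sq_nonneg _).1 h2 i (Finset.mem_univ i))
  obtain ⟨S, hSdef⟩ : ∃ S, S = (LinearMap.range J.toLinearMap).reflection := ⟨_, rfl⟩
  have hSJ : ∀ y, S (J y) = J y := fun y => by
    rw [hSdef]
    exact Submodule.reflection_mem_subspace_eq_self ⟨y, rfl⟩
  have hSS : ∀ y z, ⟪S y, z⟫_ℝ = ⟪y, S z⟫_ℝ := fun y z => by
    rw [hSdef, ← LinearIsometryEquiv.inner_map_map (LinearMap.range J.toLinearMap).reflection y,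
      Submodule.reflection_reflection]
  have hSp : ∀ z, ∃ y, (1 / 2 : ℝ) • (z + S z) = J y ∧
      ∀ y', ⟪J y', (1 / 2 : ℝ) • (z - S z)⟫_ℝ = 0 := fun z => by
    obtain ⟨⟨y, hy⟩, h2⟩ := half_reflection (LinearMap.range J.toLinearMap) z
    rw [hSdef]
    exact ⟨y, hy.symm, fun y' => (Submodule.mem_orthogonal _ _).1 h2 _ ⟨y', rfl⟩⟩
  -- `A' = S A S`. The average of `A` and `A'` is block diagonal with respect to the range of `J`
  -- and its complement, so the two blocks can be bounded separately.
  obtain ⟨A', hA'⟩ := exists_diagOn_orthonormalBasis (ε.map S) a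
  obtain ⟨c, hc0, hc⟩ : ∃ c, 0 ≤ c ∧ ∀ i, a i ≤ c :=
    ⟨∑ i, a i, Finset.sum_nonneg fun i _ => ha i,
      fun i => Finset.single_le_sum (fun i _ => ha i) (Finset.mem_univ i)⟩
  -- The crude bound `c` suffices on the complement, since only vectors `J x` are tested in the end.
  obtain ⟨B, hB⟩ := exists_diagOn_orthonormalBasis β (Sum.elim (fun _ => c) b)
  have hb' : ∀ s : ι ⊕ κ, 0 ≤ (Sum.elim (fun _ => c) b : ι ⊕ κ → ℝ) s := by
    rintro (i | j) <;> simp [hb, hc0]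
  have hApos := hA.isPositive ha
  have hA'pos := hA'.isPositive ha
  have hBpos := hB.isPositive hb'
  have hAA' : ∀ z, ⟪A' z, z⟫_ℝ = ⟪A (S z), S z⟫_ℝ := fun z => by
    rw [hA.quad_eq_sum, hA'.quad_eq_sum]
    simp only [OrthonormalBasis.map_apply, hSS]
  have hmid : (1 / 2 : ℝ) • (A + A') ≤ B := by
    rw [ContinuousLinearMap.le_def, ContinuousLinearMap.isPositive_iff]
    refine ⟨fun y z => (hBpos.isSymmetric.sub
      ((hApos.add hA'pos).smul_of_nonneg (c := (1 / 2 : ℝ)) (by norm_num)).isSymmetric) y z,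
      fun z => ?_⟩
    obtain ⟨y, hy, hn⟩ := hSp z
    obtain ⟨q, hqdef⟩ : ∃ q, q = (1 / 2 : ℝ) • (z - S z) := ⟨_, rfl⟩
    rw [← hqdef] at hn
    have hz : z = J y + q := by rw [← hy, hqdef]; module
    have hSz : S z = J y - q := by rw [← hy, hqdef]; module
    have h1 : ⟪A z, z⟫_ℝ + ⟪A' z, z⟫_ℝ = 2 * ⟪A (J y), J y⟫_ℝ + 2 * ⟪A q, q⟫_ℝ := by
      rw [hAA', hSz, hz]
      simp only [map_add, map_sub, inner_add_left, inner_add_right, inner_sub_left, inner_sub_right]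
      ring
    have h3 : ⟪A q, q⟫_ℝ ≤ c * ‖q‖ ^ 2 := by
      rw [hA.quad_eq_sum, ← ε.sum_sq_norm_inner_right q, Finset.mul_sum]
      refine Finset.sum_le_sum fun s _ => ?_
      rw [Real.norm_eq_abs, sq_abs]
      exact mul_le_mul_of_nonneg_right (hc s) (sq_nonneg _)
    have hq : ∀ j, ⟪β (Sum.inr j), q⟫_ℝ = 0 := fun j => by rw [hβr, hn]
    have h4 : ⟪B z, z⟫_ℝ = c * ‖q‖ ^ 2 + ∑ j, b j * y j ^ 2 := by
      rw [hB.quad_eq_sum, Fintype.sum_sum_type, hz, ← hsum q]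
      simp only [inner_add_right, hβJl, hβJ, hq, Sum.elim_inl, Sum.elim_inr]
      simp [Finset.mul_sum]
    have h5 : ⟪((1 / 2 : ℝ) • (A + A')) z, z⟫_ℝ = 1 / 2 * (⟪A z, z⟫_ℝ + ⟪A' z, z⟫_ℝ) := by
      rw [smul_apply, add_apply, real_inner_smul_left, inner_add_left]
    rw [sub_apply, inner_sub_left, h4, h5, h1]
    linarith [h y]
  have hmpos : ((1 / 2 : ℝ) • (A + A')).IsPositive :=
    (hApos.add hA'pos).smul_of_nonneg (by norm_num)
  have h1 := ContinuousLinearMap.IsPositive.inner_nonneg_left (hf.midpoint hApos hA'pos) (J x)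
  have h2 := hf.opFun_mono hmpos hBpos hmid (J x)
  -- `f(A') = S f(A) S`, and `S` fixes `J x`.
  have h4 : ⟪opFun f A' (J x), J x⟫_ℝ = ⟪opFun f A (J x), J x⟫_ℝ := by
    rw [(hA'.opFun_of_finite f).quad_eq_sum, (hA.opFun_of_finite f).quad_eq_sum]
    simp only [OrthonormalBasis.map_apply, hSS, hSJ]
  have h5 : ⟪opFun f B (J x), J x⟫_ℝ = ∑ j, f (b j) * x j ^ 2 := by
    rw [(hB.opFun_of_finite f).quad_eq_sum, Fintype.sum_sum_type]
    simp [hβJ, hβJl]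
  rw [sub_apply, inner_sub_left, smul_apply, add_apply, real_inner_smul_left, inner_add_left,
    h4] at h1
  linarith

/-- Jensen's inequality for operator concave functions, in finite dimension. -/
theorem OperatorConcave.jensen_finite (hf : OperatorConcave f)
    (Z : EuclideanSpace ℝ κ →L[ℝ] EuclideanSpace ℝ ι) (hZ : ∀ x, ‖Z x‖ ≤ ‖x‖)
    {a : ι → ℝ} (ha : ∀ i, 0 ≤ a i) {b : κ → ℝ} (hb : ∀ j, 0 ≤ b j)
    (h : ∀ x, ∑ i, a i * Z x i ^ 2 ≤ ∑ j, b j * x j ^ 2) (x : EuclideanSpace ℝ κ) :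
    ∑ i, f (a i) * Z x i ^ 2 ≤ ∑ j, f (b j) * x j ^ 2 := by
  obtain ⟨Y, hY⟩ := exists_complement Z hZ
  let E := EuclideanSpace ℝ (Fin (Fintype.card (ι ⊕ κ)))
  let ε : OrthonormalBasis (ι ⊕ κ) ℝ E :=
    (EuclideanSpace.basisFun _ ℝ).reindex (Fintype.equivFin (ι ⊕ κ)).symm
  let Jl : EuclideanSpace ℝ κ →ₗ[ℝ] E :=
    { toFun := fun y => ε.repr.symm (WithLp.toLp 2 (Sum.elim (Z y) (Y y)))
      map_add' := fun y z => by
        rw [← map_add]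
        congr 1
        ext (i | j) <;> simp
      map_smul' := fun r y => by
        rw [← map_smul]
        congr 1
        ext (i | j) <;> simp }
  have hJl : ∀ y, ‖Jl y‖ = ‖y‖ := fun y => by
    have h1 : ‖Jl y‖ ^ 2 = ‖y‖ ^ 2 := by
      simp only [Jl, LinearMap.coe_mk, AddHom.coe_mk, LinearIsometryEquiv.norm_map]
      rw [EuclideanSpace.norm_sq_eq, Fintype.sum_sum_type]
      simp only [Sum.elim_inl, Sum.elim_inr]
      rw [← EuclideanSpace.norm_sq_eq, ← EuclideanSpace.norm_sq_eq, hY]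
      ring
    exact (sq_eq_sq₀ (norm_nonneg _) (norm_nonneg _)).1 h1
  let J : EuclideanSpace ℝ κ →ₗᵢ[ℝ] E := ⟨Jl, hJl⟩
  have hεl : ∀ y i, ⟪ε (Sum.inl i), J y⟫_ℝ = Z y i := fun y i => by
    rw [← ε.repr_apply_apply]
    simp [J, Jl]
  have hεr : ∀ y j, ⟪ε (Sum.inr j), J y⟫_ℝ = Y y j := fun y i => by
    rw [← ε.repr_apply_apply]
    simp [J, Jl]
  -- The operator with eigenvalues `a` is extended by zero to the dilated space. Its compression by
  -- `J = (Z, Y)` does not see `Y`; after applying `f`, the extra term `f(0) ‖Y x‖²` is non-negative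
  -- and can be dropped.
  obtain ⟨A, hA⟩ := exists_diagOn_orthonormalBasis ε (Sum.elim a fun _ => 0)
  have ha' : ∀ s : ι ⊕ κ, 0 ≤ (Sum.elim a fun _ => 0 : ι ⊕ κ → ℝ) s := by
    rintro (i | j) <;> simp [ha]
  have h1 := hf.compression J rfl ha' hA hb (fun y => by
    rw [hA.quad_eq_sum, Fintype.sum_sum_type]
    simpa [hεl] using h y) x
  rw [(hA.opFun_of_finite f).quad_eq_sum, Fintype.sum_sum_type] at h1
  simp only [hεl, hεr, Sum.elim_inl, Sum.elim_inr] at h1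
  have h6 : 0 ≤ ∑ j, f 0 * Y x j ^ 2 :=
    Finset.sum_nonneg fun j _ => mul_nonneg (hf.nonneg le_rfl) (sq_nonneg _)
  linarith

end Jensen

end PosteriorContraction
namespace PosteriorContraction

/-! ### Jensen's operator inequality for diagonal operators on Hilbert spaces. -/

section JensenInfinite

variable {X X' : Type*} [NormedAddCommGroup X] [InnerProductSpace ℝ X]
  [NormedAddCommGroup X'] [InnerProductSpace ℝ X'] {ι κ : Type*}

/-- Jensen's inequality for operator concave functions and diagonal operators:
`V^* A V ≤ B` implies `V^* f(A) V ≤ f(B)` if `V` is a contraction. -/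
theorem OperatorConcave.jensen {f : ℝ → ℝ} (hf : OperatorConcave f)
    {e : HilbertBasis ι ℝ X} {a : ι → ℝ} {A fA : X →L[ℝ] X} {h : HilbertBasis κ ℝ X'} {b : κ → ℝ}
    {B fB : X' →L[ℝ] X'} (hA : DiagOn e a A) (hB : DiagOn h b B)
    (hfA : DiagOn e (fun i => f (a i)) fA) (hfB : DiagOn h (fun j => f (b j)) fB)
    (ha : ∀ i, 0 ≤ a i) (hb : ∀ j, 0 ≤ b j) (V : X' →L[ℝ] X) (hV : ∀ x, ‖V x‖ ≤ ‖x‖)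
    (hAB : ∀ x, ⟪A (V x), V x⟫_ℝ ≤ ⟪B x, x⟫_ℝ) (x : X') :
    ⟪fA (V x), V x⟫_ℝ ≤ ⟪fB x, x⟫_ℝ := by
  classical
  -- Reduction to finite sections: a finite partial sum on the left is continuous in the vector, so
  -- `x` may be truncated; the truncated right-hand side stays below the full sum.
  refine hasSum_le_of_sum_le (hfA.hasSum_quad (V x)) fun I => ?_
  have hlim : Filter.Tendsto (fun J : Finset κ => ∑ j ∈ J, ⟪h j, x⟫_ℝ • h j) Filter.atTop
      (nhds x) := by
    have := h.hasSum_repr x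
    simp only [h.repr_apply_apply] at this
    rwa [HasSum, SummationFilter.unconditional_filter] at this
  have hcont : Continuous fun z : X' => ∑ i ∈ I, f (a i) * ⟪e i, V z⟫_ℝ ^ 2 := by fun_prop
  refine le_of_tendsto ((hcont.tendsto x).comp hlim) (Filter.Eventually.of_forall fun J => ?_)
  refine le_trans ?_ (sum_le_hasSum J (fun j _ => mul_nonneg (hf.nonneg (hb j)) (sq_nonneg _))
    (hfB.hasSum_quad x))
  let w : EuclideanSpace ℝ J →ₗ[ℝ] X' :=
    { toFun := fun y => ∑ j : J, y j • h j
      map_add' := fun y z => by simp [add_smul, Finset.sum_add_distrib]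
      map_smul' := fun r y => by simp [mul_smul, Finset.smul_sum] }
  have hhJ : Orthonormal ℝ fun j : J => h j := h.orthonormal.comp _ Subtype.val_injective
  have hw : ∀ y (j : κ), ⟪h j, w y⟫_ℝ = if hj : j ∈ J then y ⟨j, hj⟩ else 0 := fun y j => by
    split_ifs with hj
    · exact hhJ.inner_right_fintype y ⟨j, hj⟩
    · simp only [w, LinearMap.coe_mk, AddHom.coe_mk, inner_sum, inner_smul_right]
      refine Finset.sum_eq_zero fun k _ => ?_
      rw [h.orthonormal.2 (show j ≠ k by rintro rfl; exact hj k.2), mul_zero]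
  have hwsum : ∀ (d : κ → ℝ) (D : X' →L[ℝ] X') (_ : DiagOn h d D) y,
      ⟪D (w y), w y⟫_ℝ = ∑ j : J, d j * y j ^ 2 := fun d D hD y => by
    refine (hD.hasSum_quad (w y)).unique ?_
    have h1 : ∑ j : J, d j * y j ^ 2 = ∑ j ∈ J, d j * ⟪h j, w y⟫_ℝ ^ 2 := by
      rw [← Finset.sum_coe_sort J]
      exact Finset.sum_congr rfl fun j _ => by rw [hw, dif_pos j.2]
    rw [h1]
    exact hasSum_sum_of_ne_finset_zero fun j hj => by rw [hw, dif_neg hj]; simp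
  have hwn : ∀ y, ‖w y‖ = ‖y‖ := fun y => by
    have := hwsum (fun _ => 1) 1 DiagOn.one y
    rw [one_apply_eq_self, real_inner_self_eq_norm_sq] at this
    refine (sq_eq_sq₀ (norm_nonneg _) (norm_nonneg _)).1 ?_
    rw [this, EuclideanSpace.norm_sq_eq]
    simp
  let Z : EuclideanSpace ℝ J →ₗ[ℝ] EuclideanSpace ℝ I :=
    { toFun := fun y => WithLp.toLp 2 fun i : I => ⟪e i, V (w y)⟫_ℝ
      map_add' := fun y z => by ext i; simp [inner_add_right]
      map_smul' := fun r y => by ext i; simp [inner_smul_right] }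
  have hZ : ∀ y i, Z y i = ⟪e i, V (w y)⟫_ℝ := fun y i => rfl
  have h1 := hf.jensen_finite Z.toContinuousLinearMap (fun y => ?_) (a := fun i : I => a i)
    (fun i => ha i) (b := fun j : J => b j) (fun j => hb j) (fun y => ?_)
    (WithLp.toLp 2 fun j : J => ⟪h j, x⟫_ℝ)
  · have hwx : w (WithLp.toLp 2 fun j : J => ⟪h j, x⟫_ℝ) = ∑ j ∈ J, ⟪h j, x⟫_ℝ • h j :=
      Finset.sum_coe_sort J fun j => ⟪h j, x⟫_ℝ • h j
    simp only [LinearMap.coe_toContinuousLinearMap', hZ, hwx] at h1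
    rw [Finset.sum_coe_sort I fun i => f (a i) * ⟪e i, V (∑ j ∈ J, ⟪h j, x⟫_ℝ • h j)⟫_ℝ ^ 2,
      Finset.sum_coe_sort J fun j => f (b j) * ⟪h j, x⟫_ℝ ^ 2] at h1
    exact h1
  · refine le_of_sq_le_sq ?_ (norm_nonneg _)
    rw [← hwn y, LinearMap.coe_toContinuousLinearMap', EuclideanSpace.norm_sq_eq]
    simp only [hZ, Real.norm_eq_abs, sq_abs]
    rw [Finset.sum_coe_sort I fun i => ⟪e i, V (w y)⟫_ℝ ^ 2]
    refine (sum_le_hasSum I (fun i _ => sq_nonneg _) (hasSum_sq_inner e (V (w y)))).trans ?_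
    exact pow_le_pow_left₀ (norm_nonneg _) (hV _) 2
  · rw [← hwsum b B hB y, LinearMap.coe_toContinuousLinearMap']
    simp only [hZ]
    rw [Finset.sum_coe_sort I fun i => a i * ⟪e i, V (w y)⟫_ℝ ^ 2]
    exact (sum_le_hasSum I (fun i _ => mul_nonneg (ha i) (sq_nonneg _))
      (hA.hasSum_quad (V (w y)))).trans (hAB _)

/-- Non-negative operator concave functions are operator monotone. -/
theorem OperatorConcave.mono {f : ℝ → ℝ} (hf : OperatorConcave f)
    {e : HilbertBasis ι ℝ X} {a : ι → ℝ} {A fA : X →L[ℝ] X} {h : HilbertBasis κ ℝ X} {b : κ → ℝ}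
    {B fB : X →L[ℝ] X} (hA : DiagOn e a A) (hB : DiagOn h b B)
    (hfA : DiagOn e (fun i => f (a i)) fA) (hfB : DiagOn h (fun j => f (b j)) fB)
    (ha : ∀ i, 0 ≤ a i) (hb : ∀ j, 0 ≤ b j)
    (hAB : ∀ x, ⟪A x, x⟫_ℝ ≤ ⟪B x, x⟫_ℝ) (x : X) :
    ⟪fA x, x⟫_ℝ ≤ ⟪fB x, x⟫_ℝ :=
  hf.jensen hA hB hfA hfB ha hb (.id ℝ X) (fun _ => le_rfl) hAB x

/-- Scalar consequences of operator concavity. -/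
theorem OperatorConcave.sq_mul_le {f : ℝ → ℝ} (hf : OperatorConcave f) {s t c : ℝ}
    (hs : 0 ≤ s) (hc : |c| ≤ 1) (hst : c ^ 2 * s ≤ t) : c ^ 2 * f s ≤ f t := by
  have ht : 0 ≤ t := le_trans (by positivity) hst
  have h1 := hf.jensen_finite (ι := Unit) (κ := Unit) (c • .id ℝ _) (a := fun _ => s)
    (b := fun _ => t) (fun x => ?_) (fun _ => hs) (fun _ => ht) (fun x => ?_)
    (WithLp.toLp 2 fun _ => 1)
  · simpa [mul_comm] using h1
  · rw [smul_apply, norm_smul, ContinuousLinearMap.id_apply]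
    exact mul_le_of_le_one_left (norm_nonneg _) hc
  · simp only [smul_apply, ContinuousLinearMap.id_apply, PiLp.smul_apply, smul_eq_mul, mul_pow,
      Finset.univ_unique, Finset.sum_singleton]
    nlinarith [sq_nonneg (x ())]

end JensenInfinite

end PosteriorContraction
namespace PosteriorContraction

/-! ### The index functions and scalar residual estimates. -/

section Scalar

variable {φ ψ : ℝ → ℝ}

theorem IsIndexFun.nonneg {f : ℝ → ℝ} (hf : IsIndexFun f) {t : ℝ} (ht : 0 ≤ t) : 0 ≤ f t := by
  rcases ht.eq_or_lt with rfl | h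
  · exact hf.zero.ge
  · exact (hf.pos t h).le

theorem theta_nonneg (hψ : IsIndexFun ψ) {t : ℝ} (ht : 0 ≤ t) : 0 ≤ Theta ψ t :=
  mul_nonneg (Real.sqrt_nonneg t) (hψ.nonneg ht)

theorem theta_zero (ψ : ℝ → ℝ) : Theta ψ 0 = 0 := by simp [Theta]

theorem theta_continuousOn (hψ : IsIndexFun ψ) : ContinuousOn (Theta ψ) (Ici 0) :=
  Real.continuous_sqrt.continuousOn.mul hψ.continuousOn

theorem theta_sq_strictMonoOn (hψ : IsIndexFun ψ) :
    StrictMonoOn (fun t => Theta ψ t ^ 2) (Ici 0) := by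
  intro s hs t ht hst
  have ht0 : 0 < t := lt_of_le_of_lt hs hst
  refine pow_lt_pow_left₀ ?_ (theta_nonneg hψ hs) two_ne_zero
  exact mul_lt_mul_of_lt_of_le_of_nonneg_of_pos (Real.sqrt_lt_sqrt hs hst)
    (hψ.monotoneOn hs ht hst.le) (Real.sqrt_nonneg s) (hψ.pos t ht0)

/-- `Θ²(t) ≥ t ψ(1)²` for `t ≥ 1`, so the intermediate value theorem reaches every level. -/
theorem theta_sq_surjOn (hψ : IsIndexFun ψ) :
    SurjOn (fun t => Theta ψ t ^ 2) (Ici 0) (Ici 0) := by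
  intro s hs
  have hs : 0 ≤ s := hs
  have h1 : 0 < ψ 1 := hψ.pos 1 one_pos
  set L := max 1 (s / ψ 1 ^ 2)
  have hL1 : 1 ≤ L := le_max_left _ _
  have hL0 : 0 ≤ L := zero_le_one.trans hL1
  have hL : s ≤ Theta ψ L ^ 2 := by
    rw [Theta, mul_pow, Real.sq_sqrt hL0]
    have h2 : ψ 1 ≤ ψ L := hψ.monotoneOn (mem_Ici.2 zero_le_one) hL0 hL1
    have h3 : s ≤ L * ψ 1 ^ 2 := (div_le_iff₀ (by positivity)).1 (le_max_right _ _)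
    exact h3.trans (by gcongr)
  obtain ⟨t, ht, hts⟩ := intermediate_value_Icc hL0
    (((theta_continuousOn hψ).pow 2).mono Icc_subset_Ici_self)
    (show s ∈ Icc _ _ by simpa [theta_zero] using ⟨hs, hL⟩)
  exact ⟨t, ht.1, hts⟩

theorem fZero_sq_theta_sq (hψ : IsIndexFun ψ) {t : ℝ} (ht : 0 ≤ t) :
    fZero ψ (Theta ψ t ^ 2) ^ 2 = t := by
  have := (theta_sq_strictMonoOn hψ).injOn.leftInvOn_invFunOn (mem_Ici.2 ht)
  rw [fZero, this, Real.sq_sqrt ht]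

theorem theta_sq_fZero_sq (hψ : IsIndexFun ψ) {s : ℝ} (hs : 0 ≤ s) :
    Theta ψ (fZero ψ s ^ 2) ^ 2 = s := by
  obtain ⟨t, ht, rfl⟩ := theta_sq_surjOn hψ hs
  simp only
  rw [fZero_sq_theta_sq hψ ht]

theorem fZero_sq_zero (hψ : IsIndexFun ψ) : fZero ψ 0 ^ 2 = 0 := by
  simpa [theta_zero] using fZero_sq_theta_sq hψ le_rfl

theorem fZero_sq_pos (hψ : IsIndexFun ψ) {s : ℝ} (hs : 0 < s) : 0 < fZero ψ s ^ 2 := by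
  refine (sq_nonneg _).lt_of_ne fun h => ?_
  have := theta_sq_fZero_sq hψ hs.le
  rw [← h, theta_zero] at this
  simp [hs.ne] at this

theorem fZero_sq_mono (hψ : IsIndexFun ψ) {s t : ℝ} (hs : 0 ≤ s) (hst : s ≤ t) :
    fZero ψ s ^ 2 ≤ fZero ψ t ^ 2 := by
  rw [← (theta_sq_strictMonoOn hψ).le_iff_le (mem_Ici.2 (sq_nonneg _)) (mem_Ici.2 (sq_nonneg _))]
  simpa only [theta_sq_fZero_sq hψ hs, theta_sq_fZero_sq hψ (hs.trans hst)] using hst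

theorem theta_fZero_sq (hψ : IsIndexFun ψ) {s : ℝ} (hs : 0 ≤ s) :
    Theta ψ (fZero ψ s ^ 2) = √s := by
  rw [← theta_sq_fZero_sq hψ hs, Real.sqrt_sq (theta_nonneg hψ (sq_nonneg _)),
    theta_sq_fZero_sq hψ hs]

/-- This turns `(φ/φ₀)²(C₀)` into `g²` of `Θ²(C₀)`, the operator that the link condition compares
with `H`. -/
theorem gSq_theta_sq (hψ : IsIndexFun ψ) {t : ℝ} (ht : 0 ≤ t) :
    gSq φ ψ (Theta ψ t ^ 2) = (φ t / √t) ^ 2 := by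
  rw [gSq, fZero_sq_theta_sq hψ ht]

/-- The dominating functions of the two factors of `φ(C₀)` multiply back to `φ² ∘ f₀²`; `φ(0) = 0`
takes care of the division by zero. -/
theorem fZero_sq_mul_gSq (hφ : φ 0 = 0) (s : ℝ) :
    fZero ψ s ^ 2 * gSq φ ψ s = φ (fZero ψ s ^ 2) ^ 2 := by
  unfold gSq
  rcases (sq_nonneg (fZero ψ s)).eq_or_lt with h | h
  · rw [← h, hφ]
    simp
  · rw [div_pow, Real.sq_sqrt h.le]
    rw [mul_div_cancel₀ _ h.ne']

theorem Prec.mul_le {k : ℝ → ℝ} (hk : Prec φ k) (hψ : IsIndexFun ψ) (hφ : IsIndexFun φ)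
    {α s : ℝ} (hα : 0 < α) (hs : α ≤ s) :
    φ (fZero ψ s ^ 2) * k (fZero ψ α ^ 2) ≤ k (fZero ψ s ^ 2) * φ (fZero ψ α ^ 2) := by
  have h1 := hk.monotoneOn (sq_nonneg (fZero ψ α)) (sq_nonneg (fZero ψ s))
    (fZero_sq_mono hψ hα.le hs)
  have h2 := hφ.pos _ (fZero_sq_pos hψ hα)
  have h3 := hφ.pos _ (fZero_sq_pos hψ (hα.trans_le hs))
  rw [div_le_div_iff₀ h2 h3] at h1
  linarith

/-- Consequence of saturation for the residual function `α / (α + t)`. -/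
theorem residual_bound_saturation (hψ : IsIndexFun ψ) (hφ : IsIndexFun φ)
    (hsat : Prec φ fun t => Theta ψ t ^ 2) {m : ℝ} (hm : 0 < m) (hm1 : m ≤ 1) {α s : ℝ}
    (hα : 0 < α) (hs : 0 ≤ s) :
    φ (fZero ψ s ^ 2) * (α / (α + m ^ 2 * s)) ≤ φ (fZero ψ α ^ 2) / m ^ 2 := by
  have hp := hφ.nonneg (sq_nonneg (fZero ψ α))
  have hm2 : m ^ 2 ≤ 1 := pow_le_one₀ hm.le hm1
  rw [le_div_iff₀ (by positivity), mul_div_assoc', div_mul_eq_mul_div, div_le_iff₀ (by positivity)]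
  -- Below `α` monotonicity of `φ` suffices; above it saturation gives `φ(f₀²(s))/s ≤ φ(f₀²(α))/α`.
  rcases le_total s α with h | h
  · have h1 : φ (fZero ψ s ^ 2) ≤ φ (fZero ψ α ^ 2) :=
      hφ.monotoneOn (mem_Ici.2 (sq_nonneg _)) (mem_Ici.2 (sq_nonneg _))
        (fZero_sq_mono hψ hs h)
    calc φ (fZero ψ s ^ 2) * α * m ^ 2 ≤ φ (fZero ψ α ^ 2) * α * 1 := by gcongr
      _ ≤ φ (fZero ψ α ^ 2) * (α + m ^ 2 * s) := by
        rw [mul_one]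
        gcongr
        nlinarith [sq_nonneg m]
  · have h1 := hsat.mul_le hψ hφ hα h
    simp only [theta_sq_fZero_sq hψ hα.le, theta_sq_fZero_sq hψ hs] at h1
    calc φ (fZero ψ s ^ 2) * α * m ^ 2 ≤ s * φ (fZero ψ α ^ 2) * m ^ 2 := by gcongr
      _ ≤ φ (fZero ψ α ^ 2) * (α + m ^ 2 * s) := by nlinarith [mul_nonneg hp hα.le]

theorem residual_bound (hψ : IsIndexFun ψ) (hφ : IsIndexFun φ)
    (hsat : Prec φ fun t => Theta ψ t ^ 2) {α s : ℝ} (hα : 0 < α) (hs : 0 ≤ s) :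
    φ (fZero ψ s ^ 2) * (α / (α + s)) ≤ φ (fZero ψ α ^ 2) := by
  simpa using residual_bound_saturation hψ hφ hsat one_pos le_rfl hα hs

/-- Sharper bound for the residual function, if `φ ≺ Θ`. -/
theorem residual_bound_regular (hψ : IsIndexFun ψ) (hφ : IsIndexFun φ)
    (hreg : Prec φ (Theta ψ)) {m : ℝ} (hm : 0 < m) (hm1 : m ≤ 1) {α s : ℝ}
    (hα : 0 < α) (hs : 0 ≤ s) :
    φ (fZero ψ s ^ 2) * (α / (α + m ^ 2 * s)) ≤ φ (fZero ψ α ^ 2) / m := by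
  have hp := hφ.nonneg (sq_nonneg (fZero ψ α))
  rw [le_div_iff₀ (by positivity), mul_div_assoc', div_mul_eq_mul_div, div_le_iff₀ (by positivity)]
  rcases le_total s α with h | h
  · have h1 : φ (fZero ψ s ^ 2) ≤ φ (fZero ψ α ^ 2) :=
      hφ.monotoneOn (mem_Ici.2 (sq_nonneg _)) (mem_Ici.2 (sq_nonneg _))
        (fZero_sq_mono hψ hs h)
    calc φ (fZero ψ s ^ 2) * α * m ≤ φ (fZero ψ α ^ 2) * α * 1 := by gcongr
      _ ≤ φ (fZero ψ α ^ 2) * (α + m ^ 2 * s) := by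
        rw [mul_one]
        gcongr
        nlinarith [sq_nonneg m]
  · have h1 := hreg.mul_le hψ hφ hα h
    simp only [theta_fZero_sq hψ hα.le, theta_fZero_sq hψ hs] at h1
    -- Above `α`, `φ ∘ f₀²` grows at most like `√s`, so this inequality between arithmetic and
    -- geometric means costs only one factor `m`.
    have h2 : √s * √α * m ≤ α + m ^ 2 * s := by
      nlinarith [sq_nonneg (√α - m * √s), Real.sq_sqrt hs, Real.sq_sqrt hα.le,
        mul_nonneg (mul_nonneg (Real.sqrt_nonneg s) (Real.sqrt_nonneg α)) hm.le]
    calc φ (fZero ψ s ^ 2) * α * m = φ (fZero ψ s ^ 2) * √α * (√α * m) := by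
          rw [← mul_assoc, mul_assoc _ √α √α, Real.mul_self_sqrt hα.le]
      _ ≤ √s * φ (fZero ψ α ^ 2) * (√α * m) := by gcongr
      _ = φ (fZero ψ α ^ 2) * (√s * √α * m) := by ring
      _ ≤ φ (fZero ψ α ^ 2) * (α + m ^ 2 * s) := by gcongr

end Scalar

end PosteriorContraction
namespace PosteriorContraction

/-! ### Order, norm bounds and compactness of diagonal operators. -/

section DiagonalBounds

variable {X : Type*} [NormedAddCommGroup X] [InnerProductSpace ℝ X] {ι : Type*}
  {e : HilbertBasis ι ℝ X} {d : ι → ℝ} {D : X →L[ℝ] X}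

theorem DiagOn.abs_le_norm (h : DiagOn e d D) (i : ι) : |d i| ≤ ‖D‖ := by
  have := D.le_opNorm (e i)
  rwa [h.apply_basis, norm_smul, e.orthonormal.1 i, mul_one, mul_one] at this

theorem DiagOn.exists_comp (h : DiagOn e d D) (hd : ∀ i, 0 ≤ d i) {f : ℝ → ℝ}
    (hf : ContinuousOn f (Ici 0)) : ∃ D', DiagOn e (fun i => f (d i)) D' := by
  obtain ⟨c, hc⟩ := (isCompact_Icc (a := (0 : ℝ)) (b := ‖D‖)).exists_bound_of_continuousOn
    (hf.mono Icc_subset_Ici_self)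
  exact DiagOn.exists_of_bounded e _ fun i =>
    hc (d i) ⟨hd i, (le_abs_self _).trans (h.abs_le_norm i)⟩

theorem DiagOn.quad_le {d' : ι → ℝ} {D' : X →L[ℝ] X} (h : DiagOn e d D) (h' : DiagOn e d' D')
    (hd : ∀ i, d i ≤ d' i) (x : X) : ⟪D x, x⟫_ℝ ≤ ⟪D' x, x⟫_ℝ :=
  hasSum_le (fun i => mul_le_mul_of_nonneg_right (hd i) (sq_nonneg _)) (h.hasSum_quad x)
    (h'.hasSum_quad x)

theorem DiagOn.norm_sq_eq {d' : ι → ℝ} {D' : X →L[ℝ] X} (h : DiagOn e d D) (h' : DiagOn e d' D')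
    (hd : ∀ i, d i ^ 2 = d' i) (x : X) : ‖D x‖ ^ 2 = ⟪D' x, x⟫_ℝ := by
  refine (h.hasSum_norm_sq x).unique ?_
  simpa only [hd] using h'.hasSum_quad x

/-- Truncations to finitely many eigenvectors have finite rank and approximate `D` in norm. -/
theorem DiagOn.isCompactOperator [CompleteSpace X] (h : DiagOn e d D)
    (hfin : ∀ η > 0, {i | η ≤ |d i|}.Finite) : IsCompactOperator D := by
  classical
  have hcl := isClosed_setOfPred_isCompactOperator (σ₁₂ := RingHom.id ℝ) (M₁ := X) (M₂ := X)
  refine hcl.closure_subset (Metric.mem_closure_iff.2 fun ε hε => ?_)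
  let s := (hfin (ε / 2) (half_pos hε)).toFinset
  have hs : DiagOn e (fun i => if i ∈ s then d i else 0)
      (∑ i ∈ s, d i • (innerSL ℝ (e i)).smulRight (e i)) := by
    intro x j
    simp only [sum_apply, smul_apply, inner_sum, inner_smul_right,
      ContinuousLinearMap.smulRight_apply, innerSL_apply_apply]
    rw [Finset.sum_congr rfl (g := fun i => if j = i then d i * ⟪e i, x⟫_ℝ else 0)]
    · simp
    · intro i _
      split_ifs with hij
      · subst hij
        simp [e.orthonormal.1 j]
      · simp [e.orthonormal.2 hij]
  refine ⟨_, ?_, (?_ : dist D (∑ i ∈ s, d i • (innerSL ℝ (e i)).smulRight (e i)) < ε)⟩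
  · refine Submodule.sum_mem (compactOperator (RingHom.id ℝ) X X) fun i _ => ?_
    refine Submodule.smul_mem _ _ ?_
    have h1 : IsCompactOperator (innerSL ℝ (e i) : X →L[ℝ] ℝ) :=
      isCompactOperator_of_locallyCompactSpace_dom (innerSL ℝ (e i) : X →L[ℝ] ℝ)
    exact h1.clm_comp (ContinuousLinearMap.toSpanSingleton ℝ (e i))
  · rw [dist_eq_norm]
    have h1 : DiagOn e (fun i => if i ∈ s then 0 else d i)
        (D - ∑ i ∈ s, d i • (innerSL ℝ (e i)).smulRight (e i)) := fun x i => by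
      rw [sub_apply, inner_sub_right, h, hs]
      beta_reduce
      split_ifs <;> ring
    refine (h1.norm_le (half_pos hε).le fun i => ?_).trans_lt (half_lt_self hε)
    split_ifs with hi
    · simpa using (half_pos hε).le
    · have : ¬ ε / 2 ≤ |d i| := by simpa [s] using hi
      exact (not_le.1 this).le

/-- Bound for a diagonal operator on vectors dominated by another diagonal operator. -/
theorem DiagOn.norm_apply_le_of_dominated {k : ι → ℝ} {K : X →L[ℝ] X} (hD : DiagOn e d D)
    (hK : DiagOn e k K) {w : X} (hw : ∀ x, ⟪w, x⟫_ℝ ^ 2 ≤ ⟪K x, x⟫_ℝ) {c : ℝ} (hc : 0 ≤ c)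
    (hdk : ∀ i, k i * d i ^ 2 ≤ c ^ 2) : ‖D w‖ ≤ c := by
  have h1 : ‖D w‖ ^ 2 = ⟪w, D (D w)⟫_ℝ := by
    rw [← hD.inner_comm, real_inner_self_eq_norm_sq]
  -- Testing with `D² w` turns the domination into `‖D w‖⁴ ≤ c² ‖D w‖²`.
  have h2 := hw (D (D w))
  have h3 : ⟪K (D (D w)), D (D w)⟫_ℝ ≤ c ^ 2 * ‖D w‖ ^ 2 := by
    refine hasSum_le (fun i => ?_) (hK.hasSum_quad _) ((hasSum_sq_inner e (D w)).mul_left (c ^ 2))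
    rw [hD (D w) i, mul_pow, ← mul_assoc]
    exact mul_le_mul_of_nonneg_right (hdk i) (sq_nonneg _)
  rw [← h1] at h2
  rcases (norm_nonneg (D w)).eq_or_lt with h0 | h0
  · rwa [← h0]
  · refine le_of_sq_le_sq ?_ hc
    nlinarith [sq_pos_of_pos h0]

end DiagonalBounds

end PosteriorContraction
namespace PosteriorContraction

universe u

/-! ### Comparison of `C₀` with functions of `H`, and the bias operator. -/

section SpectralData

variable {X : Type u} {Y : Type*} [NormedAddCommGroup X] [InnerProductSpace ℝ X] [CompleteSpace X]
  [NormedAddCommGroup Y] [InnerProductSpace ℝ Y] [CompleteSpace Y]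

/-- Eigenbases of `C₀` and of `H`. -/
structure SpectralData (T : X →L[ℝ] Y) (C₀ : X →L[ℝ] X) {ι κ : Type*} (e : HilbertBasis ι ℝ X)
    (c : ι → ℝ) (h : HilbertBasis κ ℝ X) (b : κ → ℝ) : Prop where
  diag : DiagOn e c C₀
  pos : ∀ i, 0 < c i
  fin : ∀ η > 0, {i | η ≤ c i}.Finite
  diagH : DiagOn h b (opH T C₀)
  nonnegH : ∀ j, 0 ≤ b j
  finH : ∀ η > 0, {j | η ≤ b j}.Finite

theorem opH_inner (T : X →L[ℝ] Y) (C₀ : X →L[ℝ] X) (x y : X) :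
    ⟪opH T C₀ x, y⟫_ℝ = ⟪opB T C₀ x, opB T C₀ y⟫_ℝ := by
  rw [opH, ContinuousLinearMap.comp_apply, ContinuousLinearMap.adjoint_inner_left]

theorem exists_spectralData (T : X →L[ℝ] Y) {C₀ : X →L[ℝ] X} (hC₀ : C₀.IsPositive)
    (hcpt : IsCompactOperator C₀) (hinj : Function.Injective C₀) :
    ∃ (ι κ : Type u) (e : HilbertBasis ι ℝ X) (c : ι → ℝ) (h : HilbertBasis κ ℝ X) (b : κ → ℝ),
      SpectralData T C₀ e c h b := by
  obtain ⟨ι, e, c, hC, hc, hcf⟩ := exists_diagOn_of_isPositive hcpt hC₀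
  have hpos : ∀ i, 0 < c i := fun i => by
    refine (hc i).lt_of_ne' fun h0 => ?_
    have h1 := hC.apply_basis i
    rw [h0, zero_smul] at h1
    have h2 := e.orthonormal.1 i
    rw [(map_eq_zero_iff C₀ hinj).1 h1] at h2
    simp at h2
  have hR : DiagOn e (fun i => √(c i)) (opFun Real.sqrt C₀) :=
    hC.opFun hc hcf Real.continuous_sqrt.continuousWithinAt Real.sqrt_zero
  -- Compactness of `H` is inherited from `C₀^{1/2}`.
  have hRc : IsCompactOperator (opFun Real.sqrt C₀) := hR.isCompactOperator fun η hη => by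
    refine (hcf (η ^ 2) (by positivity)).subset fun i hi => ?_
    have h1 : η ≤ √(c i) := by simpa [abs_of_nonneg (Real.sqrt_nonneg _)] using hi
    exact (Real.le_sqrt hη.le (hc i)).1 h1
  have hHc : IsCompactOperator (opH T C₀) :=
    (hRc.clm_comp T).clm_comp (opB T C₀).adjoint
  obtain ⟨κ, h, b, hH, hb, hbf⟩ := exists_diagOn_of_isPositive hHc
    (ContinuousLinearMap.isPositive_adjoint_comp_self (opB T C₀))
  exact ⟨ι, κ, e, c, h, b, hC, hpos, hcf, hH, hb, hbf⟩

/-- The operator `I - C₀^{1/2} Q B^* T` that maps `x^*` to the bias, for `Q = (αI + H)⁻¹`. -/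
noncomputable def biasOp (T : X →L[ℝ] Y) (C₀ Q : X →L[ℝ] X) : X →L[ℝ] X :=
  1 - opFun Real.sqrt C₀ ∘L Q ∘L (opB T C₀).adjoint ∘L T

namespace SpectralData

variable {T : X →L[ℝ] Y} {C₀ : X →L[ℝ] X} {ι κ : Type*} {e : HilbertBasis ι ℝ X}
  {c : ι → ℝ} {h : HilbertBasis κ ℝ X} {b : κ → ℝ} {φ ψ f : ℝ → ℝ} {m M α : ℝ}

theorem opFun_diag (s : SpectralData T C₀ e c h b) (hf : ContinuousOn f (Ici 0)) (hf0 : f 0 = 0) :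
    DiagOn e (fun i => f (c i)) (opFun f C₀) :=
  s.diag.opFun (fun i => (s.pos i).le) s.fin (hf 0 self_mem_Ici) hf0

theorem opFun_diagH (s : SpectralData T C₀ e c h b) (hf : ContinuousOn f (Ici 0))
    (hf0 : f 0 = 0) : DiagOn h (fun i => f (b i)) (opFun f (opH T C₀)) :=
  s.diagH.opFun s.nonnegH s.finH (hf 0 self_mem_Ici) hf0

theorem sqrt_diag (s : SpectralData T C₀ e c h b) :
    DiagOn e (fun i => √(c i)) (opFun Real.sqrt C₀) :=
  s.opFun_diag Real.continuous_sqrt.continuousOn Real.sqrt_zero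

theorem norm_sqrt_sq (s : SpectralData T C₀ e c h b) (x : X) :
    ‖opFun Real.sqrt C₀ x‖ ^ 2 = ⟪C₀ x, x⟫_ℝ :=
  s.sqrt_diag.norm_sq_eq s.diag (fun i => Real.sq_sqrt (s.pos i).le) x

theorem exists_theta (s : SpectralData T C₀ e c h b) (hψ : IsIndexFun ψ) :
    ∃ Θ, DiagOn e (fun i => Theta ψ (c i) ^ 2) Θ :=
  s.diag.exists_comp (fun i => (s.pos i).le) ((theta_continuousOn hψ).pow 2)

/-- Since `Θ(t) = ψ(t) √t`, the link condition at `C₀^{1/2} x` becomes a comparison of the quadratic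
forms of `Θ²(C₀)` and `H`. -/
theorem theta_quad (s : SpectralData T C₀ e c h b) (hψ : IsIndexFun ψ) {Θ : X →L[ℝ] X}
    (hΘ : DiagOn e (fun i => Theta ψ (c i) ^ 2) Θ) (x : X) :
    ⟪Θ x, x⟫_ℝ = ‖opFun ψ C₀ (opFun Real.sqrt C₀ x)‖ ^ 2 := by
  have h1 := (s.opFun_diag hψ.continuousOn hψ.zero).mul s.sqrt_diag
  rw [← _root_.mul_apply_eq_comp]
  exact (h1.norm_sq_eq hΘ (fun i => by rw [Theta, mul_comm]) x).symm

theorem theta_le_opH (s : SpectralData T C₀ e c h b) (hl : LinkCondition T C₀ ψ m M)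
    {Θ : X →L[ℝ] X} (hΘ : DiagOn e (fun i => Theta ψ (c i) ^ 2) Θ) (x : X) :
    m ^ 2 * ⟪Θ x, x⟫_ℝ ≤ ⟪opH T C₀ x, x⟫_ℝ := by
  rw [s.theta_quad hl.index hΘ, opH_inner, real_inner_self_eq_norm_sq, ← mul_pow]
  exact pow_le_pow_left₀ (mul_nonneg hl.m_pos.le (norm_nonneg _)) (hl.lower _) 2

theorem opH_le_theta (s : SpectralData T C₀ e c h b) (hl : LinkCondition T C₀ ψ m M)
    {Θ : X →L[ℝ] X} (hΘ : DiagOn e (fun i => Theta ψ (c i) ^ 2) Θ) (x : X) :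
    ⟪opH T C₀ x, x⟫_ℝ ≤ M ^ 2 * ⟪Θ x, x⟫_ℝ := by
  rw [s.theta_quad hl.index hΘ, opH_inner, real_inner_self_eq_norm_sq, ← mul_pow]
  exact pow_le_pow_left₀ (norm_nonneg _) (hl.upper _) 2

/-- The diagonal operator `H / m²`. -/
theorem scaled (s : SpectralData T C₀ e c h b) (m : ℝ) :
    DiagOn h (fun j => b j / m ^ 2) ((m ^ 2)⁻¹ • opH T C₀) :=
  (s.diagH.smul _).congr fun j => by rw [div_eq_inv_mul]

theorem theta_le_scaled (s : SpectralData T C₀ e c h b) (hl : LinkCondition T C₀ ψ m M)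
    {Θ : X →L[ℝ] X} (hΘ : DiagOn e (fun i => Theta ψ (c i) ^ 2) Θ) (x : X) :
    ⟪Θ x, x⟫_ℝ ≤ ⟪((m ^ 2)⁻¹ • opH T C₀) x, x⟫_ℝ := by
  have hm := hl.m_pos
  rw [smul_apply, real_inner_smul_left, ← div_eq_inv_mul, le_div_iff₀ (by positivity), mul_comm]
  exact s.theta_le_opH hl hΘ x

/-- `C₀ = f₀²(Θ²(C₀))`, and the operator monotone `f₀²` preserves `Θ²(C₀) ≤ H/m²`. -/
theorem sqrt_le_scaled (s : SpectralData T C₀ e c h b) (hl : LinkCondition T C₀ ψ m M)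
    {K : X →L[ℝ] X} (hK : DiagOn h (fun j => fZero ψ (b j / m ^ 2) ^ 2) K) (x : X) :
    ‖opFun Real.sqrt C₀ x‖ ^ 2 ≤ ⟪K x, x⟫_ℝ := by
  obtain ⟨Θ, hΘ⟩ := s.exists_theta hl.index
  rw [s.norm_sqrt_sq]
  refine hl.concave.mono hΘ (s.scaled m) (s.diag.congr fun i => ?_) hK (fun i => sq_nonneg _)
    (fun j => div_nonneg (s.nonnegH j) (sq_nonneg _)) (s.theta_le_scaled hl hΘ) x
  rw [fZero_sq_theta_sq hl.index (s.pos i).le]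

theorem fZero_diagH (s : SpectralData T C₀ e c h b) (hl : LinkCondition T C₀ ψ m M) :
    DiagOn h (fun j => fZero ψ (b j) ^ 2) (opFun (fun t => fZero ψ t ^ 2) (opH T C₀)) :=
  s.opFun_diagH hl.concave.continuousOn (fZero_sq_zero hl.index)

/-- The factor `m⁻²` inside `f₀²` is moved outside eigenvalue by eigenvalue, by scalar concavity. -/
theorem sqrt_le_fZero (s : SpectralData T C₀ e c h b) (hl : LinkCondition T C₀ ψ m M) (x : X) :
    m ^ 2 * ‖opFun Real.sqrt C₀ x‖ ^ 2 ≤ ⟪opFun (fun t => fZero ψ t ^ 2) (opH T C₀) x, x⟫_ℝ := by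
  have hm := hl.m_pos
  obtain ⟨K, hK⟩ := (s.scaled m).exists_comp (fun j => div_nonneg (s.nonnegH j) (sq_nonneg _))
    hl.concave.continuousOn
  have h1 := s.sqrt_le_scaled hl hK x
  have h2 := (hK.smul (m ^ 2)).quad_le (s.fZero_diagH hl) (fun j => hl.concave.sq_mul_le
    (div_nonneg (s.nonnegH j) (sq_nonneg _)) (by rw [abs_of_pos hm]; exact hl.m_le)
    (by rw [mul_div_cancel₀ _ (by positivity)])) x
  rw [smul_apply, real_inner_smul_left] at h2
  exact (mul_le_mul_of_nonneg_left h1 (sq_nonneg m)).trans h2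

/-- The upper link bound says that the contraction `M⁻¹ I` compresses `H` below `Θ²(C₀)`, so
Jensen's inequality for `f₀²` applies. -/
theorem fZero_le_sqrt (s : SpectralData T C₀ e c h b) (hl : LinkCondition T C₀ ψ m M) (x : X) :
    ⟪opFun (fun t => fZero ψ t ^ 2) (opH T C₀) x, x⟫_ℝ ≤ M ^ 2 * ‖opFun Real.sqrt C₀ x‖ ^ 2 := by
  have hM : 0 < M := one_pos.trans_le hl.le_M
  obtain ⟨Θ, hΘ⟩ := s.exists_theta hl.index
  have h1 := hl.concave.jensen s.diagH hΘ (s.fZero_diagH hl)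
    (s.diag.congr fun i => (fZero_sq_theta_sq hl.index (s.pos i).le).symm) s.nonnegH
    (fun i => sq_nonneg _) (M⁻¹ • .id ℝ X) (fun x => ?_) (fun x => ?_) x
  · simp only [smul_apply, ContinuousLinearMap.id_apply, map_smul, real_inner_smul_left,
      real_inner_smul_right, ← mul_assoc] at h1
    rw [s.norm_sqrt_sq]
    rw [← mul_inv, inv_mul_le_iff₀ (by positivity)] at h1
    rwa [sq]
  · rw [smul_apply, norm_smul, ContinuousLinearMap.id_apply, Real.norm_eq_abs,
      abs_of_pos (inv_pos.2 hM)]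
    exact mul_le_of_le_one_left (norm_nonneg _) (inv_le_one_of_one_le₀ hl.le_M)
  · simp only [smul_apply, ContinuousLinearMap.id_apply, map_smul, real_inner_smul_left,
      real_inner_smul_right, ← mul_assoc]
    rw [← mul_inv, inv_mul_le_iff₀ (by positivity), ← sq]
    exact s.opH_le_theta hl hΘ x

/-- `B = T C₀^{1/2}` lets `C₀^{1/2}` be pulled out on the left, leaving `I - Q H = α (αI + H)⁻¹`. -/
theorem biasOp_sqrt (s : SpectralData T C₀ e c h b) (hα : 0 < α) {Q D : X →L[ℝ] X}
    (hQ : DiagOn h (fun j => 1 / (α + b j)) Q) (hD : DiagOn h (fun j => α / (α + b j)) D) (w : X) :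
    biasOp T C₀ Q (opFun Real.sqrt C₀ w) = opFun Real.sqrt C₀ (D w) := by
  have h1 : D = 1 - Q * opH T C₀ := by
    refine hD.eq fun x j => ?_
    have := s.nonnegH j
    rw [sub_apply, inner_sub_right, (hQ.mul s.diagH) x j, one_apply_eq_self]
    field_simp
    ring
  have h2 : opH T C₀ w = (opB T C₀).adjoint (T (opFun Real.sqrt C₀ w)) := rfl
  simp only [h1, biasOp, sub_apply, ContinuousLinearMap.comp_apply, one_apply_eq_self, map_sub,
    _root_.mul_apply_eq_comp, h2]

/-- Bound for the bias, from domination of the factors `C₀^{1/2}` and `(φ/φ₀)(C₀)` by functions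
of `H`. -/
theorem bias_le_of_dominated (s : SpectralData T C₀ e c h b) (hφ : IsIndexFun φ) (hα : 0 < α)
    {Q : X →L[ℝ] X} (hQ : DiagOn h (fun j => 1 / (α + b j)) Q)
    {W K₁ K₂ : X →L[ℝ] X} {k₁ k₂ : κ → ℝ} (hW : DiagOn e (fun i => φ (c i) / √(c i)) W)
    (hK₁ : DiagOn h k₁ K₁) (hK₂ : DiagOn h k₂ K₂) (hk₁ : ∀ j, 0 ≤ k₁ j)
    (h₁ : ∀ x, ‖opFun Real.sqrt C₀ x‖ ^ 2 ≤ ⟪K₁ x, x⟫_ℝ) (h₂ : ∀ x, ‖W x‖ ^ 2 ≤ ⟪K₂ x, x⟫_ℝ)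
    {r : ℝ} (hr : 0 ≤ r) (hk : ∀ j, k₁ j * k₂ j * (α / (α + b j)) ^ 2 ≤ r ^ 2) {v : X}
    (hv : ‖v‖ ≤ 1) : ‖biasOp T C₀ Q (opFun φ C₀ v)‖ ≤ r := by
  have hD : DiagOn h (fun j => α / (α + b j)) (α • Q) :=
    (hQ.smul α).congr fun j => by rw [mul_one_div]
  have hφv : opFun φ C₀ v = opFun Real.sqrt C₀ (W v) := by
    rw [← _root_.mul_apply_eq_comp]
    congr 1
    refine (s.opFun_diag hφ.continuousOn hφ.zero).eq ((s.sqrt_diag.mul hW).congr fun i => ?_)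
    have := Real.sqrt_pos.2 (s.pos i)
    field_simp
  rw [hφv, s.biasOp_sqrt hα hQ hD]
  -- With `L = K₁^{1/2}` in place of `C₀^{1/2}`, only an operator diagonal in `h` acts on `W v`.
  obtain ⟨L, hL⟩ := hK₁.exists_comp hk₁ Real.continuous_sqrt.continuousOn
  have h3 : ‖opFun Real.sqrt C₀ ((α • Q) (W v))‖ ≤ ‖(L * (α • Q)) (W v)‖ := by
    refine le_of_sq_le_sq ?_ (norm_nonneg _)
    rw [_root_.mul_apply_eq_comp, hL.norm_sq_eq hK₁ fun j => Real.sq_sqrt (hk₁ j)]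
    exact h₁ _
  refine h3.trans ((hL.mul hD).norm_apply_le_of_dominated hK₂ (fun x => ?_) hr fun j => ?_)
  · refine le_trans ?_ (h₂ x)
    rw [hW.inner_comm]
    have h4 := abs_real_inner_le_norm v (W x)
    have h5 : ‖v‖ * ‖W x‖ ≤ ‖W x‖ := mul_le_of_le_one_left (norm_nonneg _) hv
    rw [← sq_abs]
    exact pow_le_pow_left₀ (abs_nonneg _) (h4.trans h5) 2
  · refine le_trans (le_of_eq ?_) (hk j)
    rw [mul_pow, Real.sq_sqrt (hk₁ j)]
    ring

end SpectralData

end SpectralData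

end PosteriorContraction
namespace PosteriorContraction

/-! ### Bias bounds in the regular, high-order and low-order cases. -/

section Factors

variable {φ ψ : ℝ → ℝ} {m α : ℝ}

/-- The product of the dominating functions of `H/m²`. -/
theorem product_bound (hφ : IsIndexFun φ) (hm : 0 < m) (hα : 0 < α) {t : ℝ} (ht : 0 ≤ t) {r : ℝ}
    (h : ∀ s, 0 ≤ s → φ (fZero ψ s ^ 2) * (α / (α + m ^ 2 * s)) ≤ r) :
    fZero ψ (t / m ^ 2) ^ 2 * gSq φ ψ (t / m ^ 2) * (α / (α + t)) ^ 2 ≤ r ^ 2 := by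
  rw [fZero_sq_mul_gSq hφ.zero, ← mul_pow]
  have h1 := h (t / m ^ 2) (by positivity)
  rw [mul_div_cancel₀ _ (by positivity : m ^ 2 ≠ 0)] at h1
  exact pow_le_pow_left₀ (mul_nonneg (hφ.nonneg (sq_nonneg _)) (by positivity)) h1 2

theorem exists_source_factor {X ι : Type*} [NormedAddCommGroup X] [InnerProductSpace ℝ X]
    {e : HilbertBasis ι ℝ X} {c : ι → ℝ} (hφ : IsIndexFun φ) (hc : ∀ i, 0 ≤ c i) {D : X →L[ℝ] X}
    (hD : DiagOn e (fun i => (φ (c i) / √(c i)) ^ 2) D) :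
    ∃ W, DiagOn e (fun i => φ (c i) / √(c i)) W := by
  obtain ⟨W, hW⟩ := hD.exists_comp (fun i => sq_nonneg _) Real.continuous_sqrt.continuousOn
  exact ⟨W, hW.congr fun i => Real.sqrt_sq (div_nonneg (hφ.nonneg (hc i)) (Real.sqrt_nonneg _))⟩

end Factors

section BiasBounds

variable {X Y : Type*} [NormedAddCommGroup X] [InnerProductSpace ℝ X] [CompleteSpace X]
  [NormedAddCommGroup Y] [InnerProductSpace ℝ Y] [CompleteSpace Y]

namespace SpectralData

variable {T : X →L[ℝ] Y} {C₀ : X →L[ℝ] X} {ι κ : Type*} {e : HilbertBasis ι ℝ X}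
  {c : ι → ℝ} {h : HilbertBasis κ ℝ X} {b : κ → ℝ} {φ ψ f : ℝ → ℝ} {m M α u : ℝ}

/-- Both factors of `φ(C₀)` are dominated at the same argument `H/m²`; `φ ≺ Θ` then limits the loss
in the residual to `1/m`. -/
theorem bias_regular (s : SpectralData T C₀ e c h b) (hl : LinkCondition T C₀ ψ m M)
    (hφ : IsIndexFun φ) (hreg : RegularCase φ ψ) (hα : 0 < α)
    {Q : X →L[ℝ] X} (hQ : DiagOn h (fun j => 1 / (α + b j)) Q) {v : X} (hv : ‖v‖ ≤ 1) :
    ‖biasOp T C₀ Q (opFun φ C₀ v)‖ ≤ φ (fZero ψ α ^ 2) / m := by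
  have hm := hl.m_pos
  obtain ⟨-, hφΘ, hg⟩ := hreg
  obtain ⟨Θ, hΘ⟩ := s.exists_theta hl.index
  obtain ⟨D, hD⟩ := hΘ.exists_comp (fun i => sq_nonneg _) hg.continuousOn
  have hD' := hD.congr fun i => gSq_theta_sq hl.index (s.pos i).le
  obtain ⟨W, hW⟩ := exists_source_factor hφ (fun i => (s.pos i).le) hD'
  have hb' : ∀ j, 0 ≤ b j / m ^ 2 := fun j => div_nonneg (s.nonnegH j) (sq_nonneg _)
  obtain ⟨K₁, hK₁⟩ := (s.scaled m).exists_comp hb' hl.concave.continuousOn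
  obtain ⟨K₂, hK₂⟩ := (s.scaled m).exists_comp hb' hg.continuousOn
  refine s.bias_le_of_dominated hφ hα hQ hW hK₁ hK₂ (fun j => sq_nonneg _)
    (s.sqrt_le_scaled hl hK₁) (fun x => ?_)
    (div_nonneg (hφ.nonneg (sq_nonneg _)) hm.le) (fun j => ?_) hv
  · rw [hW.norm_sq_eq hD' fun i => rfl]
    exact hg.mono hΘ (s.scaled m) hD hK₂ (fun i => sq_nonneg _) hb' (s.theta_le_scaled hl hΘ) x
  · exact product_bound hφ hm hα (s.nonnegH j) fun t ht =>
      residual_bound_regular hl.index hφ hφΘ hm hl.m_le hα ht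

/-- Domination of `(φ/φ₀)(C₀)` in the high-order case. -/
theorem exists_lifted (s : SpectralData T C₀ e c h b) (hψ : IsIndexFun ψ)
    (hφ : IsIndexFun φ) (hm : 0 < m) (hu : 1 < u)
    (hG : OperatorConcave fun t => gSq φ ψ (t ^ (1 / u)))
    (hlift : ∀ x, m ^ u * ‖opFun (fun t => Theta ψ t ^ u) C₀ x‖ ≤
      ‖opFun (fun t => t ^ (u / 2)) (opH T C₀) x‖) :
    ∃ W K : X →L[ℝ] X, DiagOn e (fun i => φ (c i) / √(c i)) W ∧
      DiagOn h (fun j => gSq φ ψ (b j / m ^ 2)) K ∧ ∀ x, ‖W x‖ ^ 2 ≤ ⟪K x, x⟫_ℝ := by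
  have hu0 : 0 < u := one_pos.trans hu
  have hΘu : DiagOn e (fun i => Theta ψ (c i) ^ u) (opFun (fun t => Theta ψ t ^ u) C₀) :=
    s.opFun_diag ((theta_continuousOn hψ).rpow_const fun _ _ => Or.inr hu0.le)
      (by simp [theta_zero, hu0.ne'])
  have hHu : DiagOn h (fun j => b j ^ (u / 2)) (opFun (fun t => t ^ (u / 2)) (opH T C₀)) :=
    s.opFun_diagH (Real.continuous_rpow_const (by positivity)).continuousOn
      (Real.zero_rpow (by positivity))
  -- The lifting condition amounts to `Θ^{2u}(C₀) ≤ (H/m²)^u`. The operator monotone function `t ↦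
  -- g²(t^{1/u})` undoes the power on both sides.
  have hA := hΘu.mul hΘu
  have hB := ((hHu.mul hHu).smul ((m ^ 2) ^ u)⁻¹)
  have hb' : ∀ j, 0 ≤ b j / m ^ 2 := fun j => div_nonneg (s.nonnegH j) (sq_nonneg _)
  have hA1 : ∀ i, (Theta ψ (c i) ^ u * Theta ψ (c i) ^ u) ^ (1 / u) = Theta ψ (c i) ^ 2 :=
    fun i => by
      have h0 := theta_nonneg hψ (s.pos i).le
      rw [← Real.mul_rpow h0 h0, one_div, Real.rpow_rpow_inv (by positivity) hu0.ne', sq]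
  have hB0 : ∀ j, ((m ^ 2) ^ u)⁻¹ * (b j ^ (u / 2) * b j ^ (u / 2)) = (b j / m ^ 2) ^ u :=
    fun j => by
      rw [← Real.rpow_add' (s.nonnegH j) (by linarith), add_halves,
        Real.div_rpow (s.nonnegH j) (sq_nonneg m), div_eq_inv_mul]
  have hB1 : ∀ j, ((b j / m ^ 2) ^ u) ^ (1 / u) = b j / m ^ 2 := fun j => by
    rw [one_div, Real.rpow_rpow_inv (hb' j) hu0.ne']
  have hB' := hB.congr hB0
  have hA0 : ∀ i, 0 ≤ Theta ψ (c i) ^ u * Theta ψ (c i) ^ u := fun i => mul_self_nonneg _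
  have hB0' : ∀ j, 0 ≤ (b j / m ^ 2) ^ u := fun j => Real.rpow_nonneg (hb' j) _
  obtain ⟨D, hD⟩ := hA.exists_comp hA0 hG.continuousOn
  obtain ⟨K, hK⟩ := hB'.exists_comp hB0' hG.continuousOn
  have hD' : DiagOn e (fun i => (φ (c i) / √(c i)) ^ 2) D :=
    hD.congr fun i => by rw [hA1, gSq_theta_sq hψ (s.pos i).le]
  obtain ⟨W, hW⟩ := exists_source_factor hφ (fun i => (s.pos i).le) hD'
  refine ⟨W, K, hW, hK.congr fun j => by rw [hB1], fun x => ?_⟩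
  rw [hW.norm_sq_eq hD' fun i => rfl]
  refine hG.mono hA hB' hD hK hA0 hB0' (fun y => ?_) x
  have h1 := pow_le_pow_left₀ (by positivity) (hlift y) 2
  rw [smul_apply, real_inner_smul_left, ← hΘu.norm_sq_eq hA fun i => sq _,
    ← hHu.norm_sq_eq (hHu.mul hHu) fun i => sq _, ← div_eq_inv_mul, le_div_iff₀ (by positivity)]
  rw [mul_pow] at h1
  have h2 : (m ^ 2) ^ u = (m ^ u) ^ 2 := by rw [sq, sq, Real.mul_rpow hm.le hm.le]
  rw [h2]
  linarith

/-- The residual is controlled by saturation instead of `φ ≺ Θ`, which costs a second factor `1/m`.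
-/
theorem bias_high (s : SpectralData T C₀ e c h b) (hl : LinkCondition T C₀ ψ m M)
    (hφ : IsIndexFun φ) (hsat : Prec φ fun t => Theta ψ t ^ 2) (hu : 1 < u)
    (hlift : LiftingCondition T C₀ ψ m M u) (hhigh : HighOrderIndex φ ψ u) (hα : 0 < α)
    {Q : X →L[ℝ] X} (hQ : DiagOn h (fun j => 1 / (α + b j)) Q) {v : X} (hv : ‖v‖ ≤ 1) :
    ‖biasOp T C₀ Q (opFun φ C₀ v)‖ ≤ φ (fZero ψ α ^ 2) / m ^ 2 := by
  have hm := hl.m_pos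
  obtain ⟨W, K₂, hW, hK₂, hWK⟩ :=
    s.exists_lifted hl.index hφ hm hu hhigh.2 fun x => (hlift x).1
  have hb' : ∀ j, 0 ≤ b j / m ^ 2 := fun j => div_nonneg (s.nonnegH j) (sq_nonneg _)
  obtain ⟨K₁, hK₁⟩ := (s.scaled m).exists_comp hb' hl.concave.continuousOn
  exact s.bias_le_of_dominated hφ hα hQ hW hK₁ hK₂ (fun j => sq_nonneg _)
    (s.sqrt_le_scaled hl hK₁) hWK (div_nonneg (hφ.nonneg (sq_nonneg _)) (sq_nonneg m))
    (fun j => product_bound hφ hm hα (s.nonnegH j) fun t ht =>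
      residual_bound_saturation hl.index hφ hsat hm hl.m_le hα ht) hv

/-- Equality in the upper bound and `M ≥ 1` give the lower lifting bound with `1` in place of `m`,
so `g²` can be taken at `H` itself. Only `C₀^{1/2}` contributes a factor `1/m`, through `m² C₀ ≤
f₀²(H)`. -/
theorem bias_high_eq (s : SpectralData T C₀ e c h b) (hl : LinkCondition T C₀ ψ m M)
    (hφ : IsIndexFun φ) (hsat : Prec φ fun t => Theta ψ t ^ 2) (hu : 1 < u)
    (hlift : LiftingConditionEq T C₀ ψ m M u) (hhigh : HighOrderIndex φ ψ u) (hα : 0 < α)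
    {Q : X →L[ℝ] X} (hQ : DiagOn h (fun j => 1 / (α + b j)) Q) {v : X} (hv : ‖v‖ ≤ 1) :
    ‖biasOp T C₀ Q (opFun φ C₀ v)‖ ≤ φ (fZero ψ α ^ 2) / m := by
  have hm := hl.m_pos
  have hp := hφ.nonneg (sq_nonneg (fZero ψ α))
  obtain ⟨W, K₂, hW, hK₂, hWK⟩ :=
    s.exists_lifted hl.index hφ one_pos hu hhigh.2 fun x => by
      rw [Real.one_rpow, one_mul, hlift.2 x]
      exact le_mul_of_one_le_left (norm_nonneg _)
        (Real.one_le_rpow hl.le_M (one_pos.trans hu).le)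
  refine s.bias_le_of_dominated hφ hα hQ hW ((s.fZero_diagH hl).smul (m ^ 2)⁻¹) hK₂
    (fun j => mul_nonneg (by positivity) (sq_nonneg _)) (fun x => ?_) hWK (by positivity)
    (fun j => ?_) hv
  · rw [smul_apply, real_inner_smul_left, ← div_eq_inv_mul, le_div_iff₀ (by positivity), mul_comm]
    exact s.sqrt_le_fZero hl x
  · have h1 := product_bound (ψ := ψ) (α := α) hφ one_pos hα (s.nonnegH j)
      (r := φ (fZero ψ α ^ 2)) fun t ht => by
        simpa using residual_bound hl.index hφ hsat hα ht
    rw [one_pow, div_one] at h1 ⊢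
    rw [div_pow (φ _), div_eq_inv_mul (φ _ ^ 2), mul_assoc (m ^ 2)⁻¹, mul_assoc (m ^ 2)⁻¹]
    exact mul_le_mul_of_nonneg_left h1 (by positivity)

/-- With `N` a truncation of `C₀^{-1/2}` and `L = f₀(H)`, the comparison `f₀²(H) ≤ M² C₀` makes `V =
M⁻¹ N L` a contraction. Jensen's inequality gives `V* φ²(C₀) V ≤ φ²(f₀²(H))`, which dominates `V*
φ(C₀) v`. The remaining factor `1/m` comes from replacing `C₀^{1/2}` by `L` on the left. -/
theorem bias_low (s : SpectralData T C₀ e c h b) (hl : LinkCondition T C₀ ψ m M)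
    (hφ : IsIndexFun φ) (hsat : Prec φ fun t => Theta ψ t ^ 2) (hlow : LowOrderCase φ)
    (hα : 0 < α) {Q : X →L[ℝ] X} (hQ : DiagOn h (fun j => 1 / (α + b j)) Q) {v : X}
    (hv : ‖v‖ ≤ 1) :
    ‖biasOp T C₀ Q (opFun φ C₀ v)‖ ≤ M / m * φ (fZero ψ α ^ 2) := by
  classical
  have hm := hl.m_pos
  have hM : 0 < M := one_pos.trans_le hl.le_M
  have hp := hφ.nonneg (sq_nonneg (fZero ψ α))
  have hf := hlow.2.2
  have hD : DiagOn h (fun j => α / (α + b j)) (α • Q) :=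
    (hQ.smul α).congr fun j => by rw [mul_one_div]
  have hFH := s.fZero_diagH hl
  have hφC := s.opFun_diag hφ.continuousOn hφ.zero
  obtain ⟨L, hL⟩ := hFH.exists_comp (fun j => sq_nonneg _) Real.continuous_sqrt.continuousOn
  have hLsq : ∀ x, ‖L x‖ ^ 2 = ⟪opFun (fun t => fZero ψ t ^ 2) (opH T C₀) x, x⟫_ℝ :=
    hL.norm_sq_eq hFH fun j => Real.sq_sqrt (sq_nonneg _)
  obtain ⟨fC, hfC⟩ := s.diag.exists_comp (fun i => (s.pos i).le) hf.continuousOn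
  obtain ⟨K, hK⟩ := hFH.exists_comp (fun j => sq_nonneg _) hf.continuousOn
  have hRL : ∀ x, m * ‖opFun Real.sqrt C₀ x‖ ≤ ‖L x‖ := fun x => by
    refine le_of_sq_le_sq ?_ (norm_nonneg _)
    rw [mul_pow, hLsq]
    exact s.sqrt_le_fZero hl x
  have hLR : ∀ x, ‖L x‖ ≤ M * ‖opFun Real.sqrt C₀ x‖ := fun x => by
    refine le_of_sq_le_sq ?_ (by positivity)
    rw [mul_pow, hLsq]
    exact s.fZero_le_sqrt hl x
  set y := opFun φ C₀ v
  -- Truncation to finitely many eigenvectors makes `C₀^{-1/2}` bounded; the estimate is uniform in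
  -- the truncation and passes to the limit.
  have hlim : Filter.Tendsto (fun I : Finset ι => ∑ i ∈ I, ⟪e i, y⟫_ℝ • e i) Filter.atTop
      (nhds y) := by
    have := e.hasSum_repr y
    simp only [e.repr_apply_apply] at this
    rwa [HasSum, SummationFilter.unconditional_filter] at this
  refine le_of_tendsto (((biasOp T C₀ Q).continuous.norm.tendsto y).comp hlim)
    (Filter.Eventually.of_forall fun I => ?_)
  obtain ⟨N, hN⟩ := DiagOn.exists_of_bounded e (fun i => if i ∈ I then (√(c i))⁻¹ else 0)
    (c := ∑ i ∈ I, (√(c i))⁻¹) fun i => by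
      split_ifs with hi
      · rw [abs_of_nonneg (by positivity)]
        exact Finset.single_le_sum (f := fun i => (√(c i))⁻¹) (fun _ _ => by positivity) hi
      · simpa using Finset.sum_nonneg fun i _ => (by positivity : 0 ≤ (√(c i))⁻¹)
  have hRN : DiagOn e (fun i => if i ∈ I then 1 else 0) (opFun Real.sqrt C₀ * N) :=
    (s.sqrt_diag.mul hN).congr fun i => by
      have := Real.sqrt_pos.2 (s.pos i)
      split_ifs
      · field_simp
      · simp
  have hRNy : ∑ i ∈ I, ⟪e i, y⟫_ℝ • e i = opFun Real.sqrt C₀ (N y) := by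
    rw [← _root_.mul_apply_eq_comp]
    refine hilbertBasis_ext e fun j => ?_
    rw [hRN]
    simp only [inner_sum, inner_smul_right]
    rw [Finset.sum_congr rfl (g := fun i => if j = i then ⟪e i, y⟫_ℝ else 0)]
    · simp
    · intro i _
      split_ifs with hij
      · subst hij
        simp [e.orthonormal.1 j]
      · simp [e.orthonormal.2 hij]
  have hRN1 : ∀ x, ‖(opFun Real.sqrt C₀ * N) x‖ ≤ ‖x‖ := fun x => by
    have := hRN.norm_apply_le zero_le_one (fun i => by split_ifs <;> simp) x
    rwa [one_mul] at this
  -- the contraction `V = M⁻¹ N L` and its adjoint `Z`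
  let Z : X →L[ℝ] X := M⁻¹ • (L * N)
  let V : X →L[ℝ] X := M⁻¹ • (N * L)
  have hZV : ∀ x z, ⟪Z x, z⟫_ℝ = ⟪x, V z⟫_ℝ := fun x z => by
    simp only [Z, V, smul_apply, _root_.mul_apply_eq_comp, real_inner_smul_left,
      real_inner_smul_right, hL.inner_comm, hN.inner_comm]
  have hZ : ∀ x, ‖Z x‖ ≤ ‖x‖ := fun x => by
    simp only [Z, smul_apply, norm_smul, _root_.mul_apply_eq_comp, Real.norm_eq_abs,
      abs_of_pos (inv_pos.2 hM)]
    rw [inv_mul_le_iff₀ hM]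
    exact (hLR _).trans (mul_le_mul_of_nonneg_left (hRN1 x) hM.le)
  have hV : ∀ x, ‖V x‖ ≤ ‖x‖ := fun x => by
    have h1 : ‖V x‖ * ‖V x‖ ≤ ‖V x‖ * ‖x‖ := by
      rw [← real_inner_self_eq_norm_mul_norm, ← hZV]
      exact (real_inner_le_norm _ _).trans (mul_le_mul_of_nonneg_right (hZ _) (norm_nonneg _))
    rcases (norm_nonneg (V x)).eq_or_lt with h0 | h0
    · rw [← h0]
      exact norm_nonneg x
    · exact le_of_mul_le_mul_left h1 h0
  have hjen := hf.jensen s.diag hFH hfC hK (fun i => (s.pos i).le) (fun j => sq_nonneg _) V hV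
    fun x => by
      rw [← s.norm_sqrt_sq, ← hLsq]
      refine pow_le_pow_left₀ (norm_nonneg _) ?_ 2
      simp only [V, smul_apply, _root_.mul_apply_eq_comp, map_smul, norm_smul, Real.norm_eq_abs,
        abs_of_pos (inv_pos.2 hM)]
      exact (mul_le_of_le_one_left (norm_nonneg _) (inv_le_one_of_one_le₀ hl.le_M)).trans
        (hRN1 (L x))
  have hdom : ‖(α • Q) (Z y)‖ ≤ φ (fZero ψ α ^ 2) := by
    refine hD.norm_apply_le_of_dominated hK (fun x => ?_) hp fun j => ?_
    · refine le_trans ?_ (hjen x)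
      rw [← hφC.norm_sq_eq hfC fun i => rfl, hZV, hφC.inner_comm, ← sq_abs]
      exact pow_le_pow_left₀ (abs_nonneg _) ((abs_real_inner_le_norm _ _).trans
        (mul_le_of_le_one_left (norm_nonneg _) hv)) 2
    · rw [← mul_pow]
      have := s.nonnegH j
      exact pow_le_pow_left₀ (mul_nonneg (hφ.nonneg (sq_nonneg _)) (by positivity))
        (residual_bound hl.index hφ hsat hα this) 2
  -- `L` and the residual are both functions of `H`, so `L` moves past the residual and joins `N` to
  -- form `M Z`.
  have hcomm : L ((α • Q) (N y)) = M • (α • Q) (Z y) := by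
    have h1 : L * (α • Q) = (α • Q) * L := (hL.mul hD).eq ((hD.mul hL).congr fun j => mul_comm _ _)
    rw [← _root_.mul_apply_eq_comp, h1, ← map_smul]
    simp only [Z, smul_apply, _root_.mul_apply_eq_comp, smul_inv_smul₀ hM.ne']
  rw [Function.comp_apply, hRNy, s.biasOp_sqrt hα hQ hD]
  have h2 := hRL ((α • Q) (N y))
  rw [hcomm, norm_smul, Real.norm_eq_abs, abs_of_pos hM] at h2
  rw [div_mul_eq_mul_div, le_div_iff₀ hm, mul_comm _ m]
  exact h2.trans (mul_le_mul_of_nonneg_left hdom hM.le)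

end SpectralData

end BiasBounds

end PosteriorContraction
namespace PosteriorContraction

/-! ### Traces and the resolvent. -/

section Trace

variable {X : Type*} [NormedAddCommGroup X] [InnerProductSpace ℝ X] {ι κ : Type*}

theorem tsum_ofReal_sq_inner (e : HilbertBasis ι ℝ X) (x : X) :
    ∑' i, ENNReal.ofReal (⟪e i, x⟫_ℝ ^ 2) = ENNReal.ofReal (‖x‖ ^ 2) := by
  have h := hasSum_sq_inner e x
  rw [← h.tsum_eq, ENNReal.ofReal_tsum_of_nonneg (fun i => sq_nonneg _) h.summable]

theorem DiagOn.ofReal_quad {e : HilbertBasis ι ℝ X} {d : ι → ℝ} {D : X →L[ℝ] X}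
    (h : DiagOn e d D) (hd : ∀ i, 0 ≤ d i) (x : X) :
    ENNReal.ofReal ⟪D x, x⟫_ℝ = ∑' i, ENNReal.ofReal (d i) * ENNReal.ofReal (⟪e i, x⟫_ℝ ^ 2) := by
  have hs := h.hasSum_quad x
  rw [← hs.tsum_eq, ENNReal.ofReal_tsum_of_nonneg (fun i => mul_nonneg (hd i) (sq_nonneg _))
    hs.summable]
  simp_rw [ENNReal.ofReal_mul (hd _)]

/-- Trace of `A^* D A` for a diagonal operator `D` and a self-adjoint operator `A`. -/
theorem DiagOn.tsum_conj {e : HilbertBasis ι ℝ X} {d : ι → ℝ} {D A : X →L[ℝ] X}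
    (h : DiagOn e d D) (hd : ∀ i, 0 ≤ d i) (hA : ∀ x y, ⟪A x, y⟫_ℝ = ⟪x, A y⟫_ℝ)
    (g : HilbertBasis κ ℝ X) :
    ∑' j, ENNReal.ofReal ⟪D (A (g j)), A (g j)⟫_ℝ =
      ∑' i, ENNReal.ofReal (d i) * ENNReal.ofReal (‖A (e i)‖ ^ 2) := by
  simp_rw [h.ofReal_quad hd]
  rw [ENNReal.tsum_comm]
  refine tsum_congr fun i => ?_
  rw [ENNReal.tsum_mul_left, ← tsum_ofReal_sq_inner g]
  congr 1
  exact tsum_congr fun j => by rw [← hA, real_inner_comm]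

theorem DiagOn.opTrace_eq [CompleteSpace X] {e : HilbertBasis ι ℝ X} {d : ι → ℝ} {D : X →L[ℝ] X}
    (h : DiagOn e d D) (hd : ∀ i, 0 ≤ d i) : opTrace D = ∑' i, ENNReal.ofReal (d i) := by
  have := h.tsum_conj hd (A := 1) (fun x y => rfl) (someBasis X)
  simp only [one_apply_eq_self] at this
  rw [opTrace, this]
  simp [e.orthonormal.1]

theorem DiagOn.ringInverse {e : HilbertBasis ι ℝ X} {b : ι → ℝ} {H : X →L[ℝ] X} {α : ℝ}
    (hα : 0 < α) (hb : ∀ i, 0 ≤ b i) (hH : DiagOn e b H) :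
    DiagOn e (fun i => 1 / (α + b i)) (Ring.inverse (α • (1 : X →L[ℝ] X) + H)) := by
  have hA : DiagOn e (fun i => α * 1 + b i) (α • (1 : X →L[ℝ] X) + H) :=
    (DiagOn.one.smul α).add hH
  obtain ⟨Q, hQ⟩ := DiagOn.exists_of_bounded e (fun i => 1 / (α + b i)) (c := 1 / α) fun i => by
    have := hb i
    rw [abs_of_nonneg (by positivity)]
    exact one_div_le_one_div_of_le hα (by linarith)
  have h1 : (α • (1 : X →L[ℝ] X) + H) * Q = 1 := (hA.mul hQ).eq (DiagOn.one.congr fun i => by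
    have := hb i
    field_simp)
  have h2 : Q * (α • (1 : X →L[ℝ] X) + H) = 1 := (hQ.mul hA).eq (DiagOn.one.congr fun i => by
    have := hb i
    field_simp)
  have h3 : Ring.inverse (α • (1 : X →L[ℝ] X) + H) = Q :=
    Ring.inverse_unit ⟨α • (1 : X →L[ℝ] X) + H, Q, h1, h2⟩
  rwa [h3]

end Trace

section TraceBound

variable {X Y : Type*} [NormedAddCommGroup X] [InnerProductSpace ℝ X] [CompleteSpace X]
  [NormedAddCommGroup Y] [InnerProductSpace ℝ Y] [CompleteSpace Y]

/-- The sum does not depend on the basis. In the eigenbasis of `H`, where `Q` is diagonal, `m² C₀ ≤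
f₀²(H)` enters only through its values at the eigenvectors. -/
theorem SpectralData.trace_le {T : X →L[ℝ] Y} {C₀ : X →L[ℝ] X} {ι κ : Type*}
    {e : HilbertBasis ι ℝ X} {c : ι → ℝ} {h : HilbertBasis κ ℝ X} {b : κ → ℝ} {ψ : ℝ → ℝ}
    {m M α : ℝ} (s : SpectralData T C₀ e c h b) (hl : LinkCondition T C₀ ψ m M) (hα : 0 < α)
    {Q : X →L[ℝ] X} (hQ : DiagOn h (fun j => 1 / (α + b j)) Q) {τ : Type*}
    (g : HilbertBasis τ ℝ X) :
    ∑' j, ENNReal.ofReal ⟪Q (opFun Real.sqrt C₀ (g j)), opFun Real.sqrt C₀ (g j)⟫_ℝ ≤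
      ENNReal.ofReal ((1 / m) ^ 2) *
        opTrace (Q * opFun (fun t => fZero ψ t ^ 2) (opH T C₀)) := by
  have hm := hl.m_pos
  have hq : ∀ j, 0 ≤ 1 / (α + b j) := fun j => by
    have := s.nonnegH j
    positivity
  rw [hQ.tsum_conj hq s.sqrt_diag.inner_comm,
    (hQ.mul (s.fZero_diagH hl)).opTrace_eq fun j => mul_nonneg (hq j) (sq_nonneg _),
    ← ENNReal.tsum_mul_left]
  refine ENNReal.tsum_le_tsum fun j => ?_
  rw [← ENNReal.ofReal_mul (hq j), ← ENNReal.ofReal_mul (sq_nonneg _)]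
  refine ENNReal.ofReal_le_ofReal ?_
  have h1 := s.sqrt_le_fZero hl (h j)
  rw [(s.fZero_diagH hl).apply_basis, real_inner_smul_left, real_inner_self_eq_norm_sq,
    h.orthonormal.1 j, one_pow, mul_one] at h1
  rw [mul_left_comm]
  refine mul_le_mul_of_nonneg_left ?_ (hq j)
  rw [one_div, inv_pow, ← div_eq_inv_mul, le_div_iff₀ (by positivity)]
  linarith

end TraceBound

end PosteriorContraction
namespace PosteriorContraction

/-! ### Gaussian linear forms in the parameter and the noise. -/

section GaussianForms

variable {X Y Ω : Type*} [NormedAddCommGroup X] [InnerProductSpace ℝ X]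
  [MeasurableSpace X] [NormedAddCommGroup Y] [InnerProductSpace ℝ Y]
  [MeasurableSpace Ω] {P : Measure Ω} {μ : Measure X} {W : Y → Ω → ℝ} {C : X →L[ℝ] X}

/-- The continuous linear functionals have law `N(0, ⟪C a, a⟫)` under `μ`. -/
def HasGaussianPairings (μ : Measure X) (C : X →L[ℝ] X) : Prop :=
  ∀ a, μ.map (fun x => ⟪x, a⟫_ℝ) = gaussianReal 0 (Real.toNNReal ⟪C a, a⟫_ℝ)

/-- `V` is a version of `⟪x, a⟫ + ⟪ξ, b⟫`. -/
structure IsLinearForm (μ : Measure X) (P : Measure Ω) (W : Y → Ω → ℝ) (V : X × Ω → ℝ)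
    (a : X) (b : Y) : Prop where
  measurable : Measurable V
  ae_eq : V =ᵐ[μ.prod P] fun p => ⟪p.1, a⟫_ℝ + W b p.2

theorem IsWhiteNoise.ae_zero (hW : IsWhiteNoise P W) :
    ∀ᵐ ω ∂P, W 0 ω = 0 := by
  filter_upwards [hW.smul 0 0] with ω hω
  simpa using hω

namespace IsLinearForm

variable {V V' : X × Ω → ℝ} {a a' : X} {b b' : Y}

theorem add (hW : IsWhiteNoise P W) (h : IsLinearForm μ P W V a b)
    (h' : IsLinearForm μ P W V' a' b') :
    IsLinearForm μ P W (V + V') (a + a') (b + b') := by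
  refine ⟨h.measurable.add h'.measurable, ?_⟩
  filter_upwards [h.ae_eq, h'.ae_eq, Measure.quasiMeasurePreserving_snd.ae (hW.add b b')]
    with p h1 h2 h3
  rw [Pi.add_apply, h1, h2, h3, inner_add_right]
  ring

theorem const_mul (hW : IsWhiteNoise P W) (h : IsLinearForm μ P W V a b) (r : ℝ) :
    IsLinearForm μ P W (fun p => r * V p) (r • a) (r • b) := by
  refine ⟨h.measurable.const_mul r, ?_⟩
  filter_upwards [h.ae_eq, Measure.quasiMeasurePreserving_snd.ae (hW.smul r b)] with p h1 h2
  rw [h1, h2, inner_smul_right]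
  ring

theorem zero (hW : IsWhiteNoise P W) : IsLinearForm μ P W (fun _ => 0) 0 0 := by
  refine ⟨measurable_const, ?_⟩
  filter_upwards [(Measure.quasiMeasurePreserving_snd (μ := μ)).ae hW.ae_zero] with p h
  simp [h]

theorem sum (hW : IsWhiteNoise P W) {S : Type*} (I : Finset S) {U : S → X × Ω → ℝ} {A : S → X}
    {B : S → Y} (h : ∀ s, IsLinearForm μ P W (U s) (A s) (B s)) (r : S → ℝ) :
    IsLinearForm μ P W (fun p => ∑ s ∈ I, r s * U s p) (∑ s ∈ I, r s • A s)
      (∑ s ∈ I, r s • B s) := by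
  classical
  induction I using Finset.induction_on with
  | empty => simpa using zero hW
  | insert i I hi ih =>
    simp only [Finset.sum_insert hi]
    exact ((h i).const_mul hW (r i)).add hW ih

theorem noise (hW : IsWhiteNoise P W) (b : Y) :
    IsLinearForm μ P W (fun p => W b p.2) 0 b :=
  ⟨(hW.measurable b).comp measurable_snd, by simp⟩

variable [IsProbabilityMeasure P] [IsProbabilityMeasure μ] [OpensMeasurableSpace X]

theorem map_eq (hW : IsWhiteNoise P W) (hC : C.IsPositive) (hμ : HasGaussianPairings μ C)
    (h : IsLinearForm μ P W V a b) :
    (μ.prod P).map V = gaussianReal 0 (Real.toNNReal (⟪C a, a⟫_ℝ + ‖b‖ ^ 2)) := by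
  have hm : Measurable fun x : X => ⟪x, a⟫_ℝ :=
    Continuous.measurable (by fun_prop : Continuous fun x : X => ⟪x, a⟫_ℝ)
  have hind : IndepFun (fun p : X × Ω => ⟪p.1, a⟫_ℝ) (fun p => W b p.2) (μ.prod P) :=
    indepFun_prod hm (hW.measurable b)
  have h1 : (μ.prod P).map (fun p => ⟪p.1, a⟫_ℝ) =
      gaussianReal 0 (Real.toNNReal ⟪C a, a⟫_ℝ) := by
    have := Measure.map_map (μ := μ.prod P) hm measurable_fst
    rw [Measure.map_fst_prod, measure_univ, one_smul, hμ a] at this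
    exact this.symm
  have h2 : (μ.prod P).map (fun p => W b p.2) = gaussianReal 0 (‖b‖₊ ^ 2) := by
    have := Measure.map_map (μ := μ.prod P) (hW.measurable b) measurable_snd
    rw [Measure.map_snd_prod, measure_univ, one_smul, hW.law b] at this
    exact this.symm
  rw [Measure.map_congr h.ae_eq]
  have := gaussianReal_add_gaussianReal_of_indepFun hind h1 h2
  rw [add_zero] at this
  convert! this using 2
  rw [Real.toNNReal_add (hC.inner_nonneg_left a) (sq_nonneg _), Real.toNNReal_pow (norm_nonneg _),
    norm_toNNReal]

/-- Linear forms are closed under finite combinations up to null sets, and each is normal, so all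
finite-dimensional laws are Gaussian. -/
theorem isGaussianProcess (hW : IsWhiteNoise P W) (hC : C.IsPositive)
    (hμ : HasGaussianPairings μ C) {S : Type*} {U : S → X × Ω → ℝ} {A : S → X}
    {B : S → Y} (h : ∀ s, IsLinearForm μ P W (U s) (A s) (B s)) :
    IsGaussianProcess U (μ.prod P) := by
  classical
  refine ⟨fun I => ⟨isGaussian_of_map_eq_gaussianReal fun L => ?_⟩⟩
  have hmeas : Measurable fun ω => I.restrict (U · ω) :=
    measurable_pi_lambda _ fun i => (h i).measurable
  rw [Measure.map_map (by fun_prop) hmeas]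
  have hL : (L ∘ fun ω => I.restrict (U · ω)) =
      fun ω => ∑ s : I, L (Pi.single s 1) * U s ω := by
    ext ω
    rw [Function.comp_apply, ← L.coe_coe, LinearMap.pi_apply_eq_sum_univ]
    refine Finset.sum_congr rfl fun s _ => ?_
    rw [smul_eq_mul, mul_comm, L.coe_coe]
    congr 2
    ext t
    simp [Pi.single_apply, eq_comm]
  rw [hL]
  exact ⟨_, _, (sum hW Finset.univ (fun s : I => h s) fun s => L (Pi.single s 1)).map_eq hW hC hμ⟩

theorem memLp (hW : IsWhiteNoise P W) (hC : C.IsPositive) (hμ : HasGaussianPairings μ C)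
    (h : IsLinearForm μ P W V a b) : MemLp V 2 (μ.prod P) := by
  have : HasGaussianLaw V (μ.prod P) := ⟨by rw [h.map_eq hW hC hμ]; infer_instance⟩
  exact this.memLp_two

theorem variance_eq (hW : IsWhiteNoise P W) (hC : C.IsPositive) (hμ : HasGaussianPairings μ C)
    (h : IsLinearForm μ P W V a b) : Var[V; μ.prod P] = ⟪C a, a⟫_ℝ + ‖b‖ ^ 2 := by
  have h1 := variance_map (X := id) (μ := μ.prod P) aemeasurable_id h.measurable.aemeasurable
  rw [h.map_eq hW hC hμ, variance_id_gaussianReal] at h1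
  rw [← Function.id_comp V, ← h1, Real.coe_toNNReal]
  exact add_nonneg (hC.inner_nonneg_left a) (sq_nonneg _)

theorem covariance_eq (hW : IsWhiteNoise P W) (hC : C.IsPositive) (hμ : HasGaussianPairings μ C)
    (h : IsLinearForm μ P W V a b) (h' : IsLinearForm μ P W V' a' b') :
    cov[V, V'; μ.prod P] = ⟪C a, a'⟫_ℝ + ⟪b, b'⟫_ℝ := by
  have h1 := variance_add (h.memLp hW hC hμ) (h'.memLp hW hC hμ)
  rw [(h.add hW h').variance_eq hW hC hμ, h.variance_eq hW hC hμ, h'.variance_eq hW hC hμ,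
    map_add, inner_add_left, inner_add_right, inner_add_right, norm_add_sq_real,
    hC.inner_left_eq_inner_right a' a, real_inner_comm _ a'] at h1
  linarith

/-- Orthogonal linear forms are independent. -/
theorem indepFun (hW : IsWhiteNoise P W) (hC : C.IsPositive) (hμ : HasGaussianPairings μ C)
    (h : IsLinearForm μ P W V a b) {S : Type*} {U : S → X × Ω → ℝ} {A : S → X} {B : S → Y}
    (hU : ∀ s, IsLinearForm μ P W (U s) (A s) (B s))
    (horth : ∀ s, ⟪C a, A s⟫_ℝ + ⟪b, B s⟫_ℝ = 0) :
    IndepFun V (fun p s => U s p) (μ.prod P) := by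
  -- `V` is adjoined to the family: within one Gaussian process, vanishing covariance means
  -- independence.
  have h1 : IsGaussianProcess (Sum.elim (fun _ : Unit => V) U) (μ.prod P) :=
    isGaussianProcess hW hC hμ (A := Sum.elim (fun _ => a) A) (B := Sum.elim (fun _ => b) B) (by
      rintro (_ | s)
      · exact h
      · exact hU s)
  have h2 := h1.indepFun_of_covariance_eq_zero (fun _ => h.measurable.aemeasurable)
    (fun s => (hU s).measurable.aemeasurable)
    fun _ s => by rw [h.covariance_eq hW hC hμ (hU s), horth]
  exact h2.comp (φ := fun f : Unit → ℝ => f ()) (ψ := id) (measurable_pi_apply _) measurable_id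

end IsLinearForm

theorem lintegral_sq_gaussianReal (t : ℝ) (v : NNReal) :
    ∫⁻ r, ENNReal.ofReal ((t - r) ^ 2) ∂gaussianReal 0 v = ENNReal.ofReal (t ^ 2 + v) := by
  have hid : MemLp (fun r : ℝ => r) 2 (gaussianReal 0 v) := memLp_id_gaussianReal 2
  have hsq : Integrable (fun r : ℝ => r ^ 2) (gaussianReal 0 v) := hid.integrable_sq
  have hint : Integrable (fun r : ℝ => r) (gaussianReal 0 v) := hid.integrable (by norm_num)
  have hv : ∫ r, r ^ 2 ∂gaussianReal 0 v = v := by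
    rw [← variance_of_integral_eq_zero hint.aemeasurable integral_id_gaussianReal,
      variance_fun_id_gaussianReal]
  have h1 : Integrable (fun r : ℝ => t ^ 2 - 2 * t * r) (gaussianReal 0 v) :=
    (integrable_const _).sub (hint.const_mul _)
  have h2 : (fun r : ℝ => (t - r) ^ 2) = fun r => t ^ 2 - 2 * t * r + r ^ 2 := by
    ext r
    ring
  rw [← ofReal_integral_eq_lintegral_ofReal (by rw [h2]; exact h1.add hsq)
    (Filter.Eventually.of_forall fun r => sq_nonneg _), h2, integral_add h1 hsq,
    integral_sub (integrable_const _) (hint.const_mul _), integral_const_mul,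
    integral_id_gaussianReal, hv]
  simp

end GaussianForms

end PosteriorContraction
namespace PosteriorContraction

/-! ### Posterior integrals from an independent residual. -/

section Posterior

/-- A residual `ℓ(x) - D(z)` independent of the data keeps its law `ν` after conditioning. The proof
integrates over an arbitrary set of data and disintegrates the joint law in both orders. -/
theorem ae_posterior_lintegral_of_indepFun {X Z : Type*} [MeasurableSpace X]
    [StandardBorelSpace X] [Nonempty X] [MeasurableSpace Z] {k : Kernel X Z} [IsMarkovKernel k]
    {μ : Measure X} [IsProbabilityMeasure μ] {ℓ : X → ℝ} {D : Z → ℝ} {ν : Measure ℝ} [SFinite ν]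
    (hℓ : Measurable ℓ) (hD : Measurable D)
    (hind : IndepFun (fun q => ℓ q.1 - D q.2) Prod.snd (μ ⊗ₘ k))
    (hν : (μ ⊗ₘ k).map (fun q => ℓ q.1 - D q.2) = ν) {f : ℝ → ℝ≥0∞} (hf : Measurable f) :
    ∀ᵐ z ∂(k ∘ₘ μ), ∫⁻ x, f (ℓ x) ∂(posterior k μ z) = ∫⁻ r, f (D z + r) ∂ν := by
  have hr : Measurable fun q : X × Z => ℓ q.1 - D q.2 := by fun_prop
  have hfℓ : Measurable fun x => f (ℓ x) := hf.comp hℓ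
  have hfD : Measurable fun q : Z × ℝ => f (D q.1 + q.2) := by fun_prop
  refine ae_eq_of_forall_setLIntegral_eq_of_sigmaFinite hfℓ.lintegral_kernel
    hfD.lintegral_prod_right' fun A hA _ => ?_
  have hind' := hind.map_prod_eq_prod_map_map hr.aemeasurable measurable_snd.aemeasurable
  rw [hν, ← Measure.snd, Measure.snd_compProd] at hind'
  have e1 : Measurable fun q : Z × X => A.indicator (fun _ => (1 : ℝ≥0∞)) q.1 * f (ℓ q.2) :=
    ((measurable_const.indicator hA).comp measurable_fst).mul (hfℓ.comp measurable_snd)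
  have e2 : Measurable fun q : ℝ × Z => A.indicator (fun _ => (1 : ℝ≥0∞)) q.2 * f (D q.2 + q.1) :=
    ((measurable_const.indicator hA).comp measurable_snd).mul (by fun_prop)
  calc ∫⁻ z in A, ∫⁻ x, f (ℓ x) ∂(posterior k μ z) ∂(k ∘ₘ μ)
      = ∫⁻ q, A.indicator (fun _ => (1 : ℝ≥0∞)) q.1 * f (ℓ q.2)
          ∂((k ∘ₘ μ) ⊗ₘ posterior k μ) := by
        rw [Measure.lintegral_compProd e1, ← lintegral_indicator hA]
        refine lintegral_congr fun z => ?_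
        dsimp only
        rw [lintegral_const_mul _ hfℓ]
        by_cases hz : z ∈ A <;> simp [hz]
    _ = ∫⁻ q, A.indicator (fun _ => (1 : ℝ≥0∞)) q.2 * f (ℓ q.1) ∂(μ ⊗ₘ k) := by
        rw [compProd_posterior_eq_map_swap, lintegral_map e1 measurable_swap]
        rfl
    _ = ∫⁻ q, A.indicator (fun _ => (1 : ℝ≥0∞)) q.2 * f (D q.2 + q.1) ∂(ν.prod (k ∘ₘ μ)) := by
        rw [← hind', lintegral_map e2 (hr.prodMk measurable_snd)]
        simp
    _ = ∫⁻ z in A, ∫⁻ r, f (D z + r) ∂ν ∂(k ∘ₘ μ) := by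
        rw [lintegral_prod_symm' _ e2, ← lintegral_indicator hA]
        refine lintegral_congr fun z => ?_
        dsimp only
        rw [lintegral_const_mul _ (by fun_prop)]
        by_cases hz : z ∈ A <;> simp [hz]

end Posterior

theorem map_prod_comp_snd {X Ω Z : Type*} [MeasurableSpace X] [MeasurableSpace Ω]
    [MeasurableSpace Z] {μ : Measure X} [IsProbabilityMeasure μ] {P : Measure Ω}
    [IsProbabilityMeasure P] {F : Ω → Z} (hF : Measurable F) :
    (μ.prod P).map (fun p => F p.2) = P.map F := by
  have := Measure.map_map (μ := μ.prod P) hF measurable_snd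
  rw [Measure.map_snd_prod, measure_univ, one_smul] at this
  exact this.symm

/-! ### Law of the data and second moments of the posterior. -/

section Data

variable {X Y Ω : Type*} [NormedAddCommGroup X] [InnerProductSpace ℝ X]
  [NormedAddCommGroup Y] [InnerProductSpace ℝ Y]
  [MeasurableSpace Ω] [MeasurableSpace X] [BorelSpace X]
  {T : X →L[ℝ] Y} {P : Measure Ω} {W : Y → Ω → ℝ} {μ : Measure X} {C : X →L[ℝ] X} {δ : ℝ}

theorem measurable_inner_right (a : X) : Measurable fun x : X => ⟪x, a⟫_ℝ :=
  Continuous.measurable (by fun_prop : Continuous fun x : X => ⟪x, a⟫_ℝ)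

theorem measurable_data (hW : IsWhiteNoise P W) :
    Measurable fun p : X × Ω => fun y => ⟪T p.1, y⟫_ℝ + δ * W y p.2 := by
  refine measurable_pi_lambda _ fun y => ?_
  refine Measurable.add ?_ (((hW.measurable y).comp measurable_snd).const_mul δ)
  exact (Continuous.measurable (by fun_prop : Continuous fun x : X => ⟪T x, y⟫_ℝ)).comp
    measurable_fst

theorem measurable_data_right (hW : IsWhiteNoise P W) (x : X) :
    Measurable fun ω : Ω => fun y => ⟪T x, y⟫_ℝ + δ * W y ω :=
  (measurable_data hW).comp measurable_prodMk_left

variable [IsProbabilityMeasure P] [IsProbabilityMeasure μ]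

theorem dataKernel_apply (hW : IsWhiteNoise P W) (x : X) :
    dataKernel T P W δ x = P.map fun ω y => ⟪T x, y⟫_ℝ + δ * W y ω := by
  rw [dataKernel, Kernel.map_apply _ (measurable_data hW), Kernel.prod_apply, Kernel.id_apply,
    Kernel.const_apply, Measure.dirac_prod, Measure.map_map (measurable_data hW)
    measurable_prodMk_left]
  rfl

theorem isMarkovKernel_dataKernel (hW : IsWhiteNoise P W) :
    IsMarkovKernel (dataKernel T P W δ) :=
  Kernel.IsMarkovKernel.map _ (measurable_data hW)

theorem compProd_dataKernel (hW : IsWhiteNoise P W) :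
    μ ⊗ₘ dataKernel T P W δ =
      (μ.prod P).map fun p => (p.1, fun y => ⟪T p.1, y⟫_ℝ + δ * W y p.2) := by
  have := isMarkovKernel_dataKernel (T := T) (δ := δ) hW
  refine Measure.ext_of_lintegral _ fun f hf => ?_
  rw [Measure.lintegral_compProd hf, lintegral_map hf (measurable_fst.prodMk (measurable_data hW)),
    lintegral_prod (fun p => f (p.1, fun y => ⟪T p.1, y⟫_ℝ + δ * W y p.2))
      (hf.comp (measurable_fst.prodMk (measurable_data hW))).aemeasurable]
  refine lintegral_congr fun x => ?_
  rw [dataKernel_apply hW, lintegral_map (f := fun z => f (x, z)) (hf.comp measurable_prodMk_left)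
    (measurable_data_right hW x)]

/-- Cameron--Martin: the laws of the data for different parameters are equivalent. -/
theorem dataKernel_absolutelyContinuous (hW : IsWhiteNoise P W) (hC : C.IsPositive)
    (hμ : HasGaussianPairings μ C) (hδ : δ ≠ 0) (x x' : X) :
    dataKernel T P W δ x' ≪ dataKernel T P W δ x := by
  rw [dataKernel_apply hW, dataKernel_apply hW]
  obtain ⟨k, hk⟩ : ∃ k : Y, T x' = T x + δ • k :=
    ⟨δ⁻¹ • (T x' - T x), by rw [smul_inv_smul₀ hδ]; abel⟩
  rcases eq_or_ne k 0 with rfl | hk0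
  · rw [hk, smul_zero, add_zero]
  have hk2 : ‖k‖ ^ 2 ≠ 0 := by positivity
  have hv : ‖k‖₊ ^ 2 ≠ 0 := by simpa using hk0
  -- `N` is the part of the noise orthogonal to `k`, independent of `W k`. Passing from `T x` to `T
  -- x'` only shifts `W k` by `‖k‖²`, and normal laws on the line with the same positive variance
  -- are equivalent.
  let N : Ω → Y → ℝ := fun ω y => W y ω + -(⟪k, y⟫_ℝ / ‖k‖ ^ 2) * W k ω
  have hN : Measurable N := measurable_pi_lambda _ fun y =>
    (hW.measurable y).add ((hW.measurable k).const_mul _)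
  have hform : ∀ y, IsLinearForm μ P W (fun p => N p.2 y) (0 + -(⟪k, y⟫_ℝ / ‖k‖ ^ 2) • 0)
      (y + -(⟪k, y⟫_ℝ / ‖k‖ ^ 2) • k) := fun y =>
    (IsLinearForm.noise hW y).add hW ((IsLinearForm.noise hW k).const_mul hW _)
  have hind := (IsLinearForm.noise hW k).indepFun hW hC hμ hform fun y => by
    rw [map_zero, inner_zero_left, inner_add_right, inner_smul_right, real_inner_self_eq_norm_sq]
    field_simp
    ring
  have hprod : P.map (fun ω => (W k ω, N ω)) = (P.map (W k)).prod (P.map N) := by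
    have := (indepFun_iff_map_prod_eq_prod_map_map (f := fun p : X × Ω => W k p.2)
      (g := fun p => N p.2) ((hW.measurable k).comp measurable_snd).aemeasurable
      (hN.comp measurable_snd).aemeasurable).1 hind
    rwa [map_prod_comp_snd (hW.measurable k), map_prod_comp_snd hN,
      map_prod_comp_snd (F := fun ω => (W k ω, N ω)) ((hW.measurable k).prodMk hN)] at this
  let Φ : ℝ × (Y → ℝ) → Y → ℝ := fun q y =>
    ⟪T x, y⟫_ℝ + δ * (q.2 y + ⟪k, y⟫_ℝ / ‖k‖ ^ 2 * q.1)
  have hΦ : Measurable Φ := measurable_pi_lambda _ fun y => by fun_prop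
  have h1 : P.map (fun ω y => ⟪T x, y⟫_ℝ + δ * W y ω) =
      ((gaussianReal 0 (‖k‖₊ ^ 2)).prod (P.map N)).map Φ := by
    rw [← hW.law k, ← hprod, Measure.map_map hΦ ((hW.measurable k).prodMk hN)]
    congr 1
    ext ω y
    simp only [Φ, N, Function.comp_apply]
    ring
  have h2 : P.map (fun ω y => ⟪T x', y⟫_ℝ + δ * W y ω) =
      ((gaussianReal (‖k‖ ^ 2) (‖k‖₊ ^ 2)).prod (P.map N)).map Φ := by
    have h3 : (gaussianReal (‖k‖ ^ 2) (‖k‖₊ ^ 2)).prod (P.map N) =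
        P.map fun ω => (W k ω + ‖k‖ ^ 2, N ω) := by
      have := Measure.map_prod_map (P.map (W k)) (P.map N)
        (f := (· + ‖k‖ ^ 2)) (g := id) (by fun_prop) measurable_id
      rw [Measure.map_id, ← hprod, Measure.map_map (by fun_prop) ((hW.measurable k).prodMk hN),
        hW.law k, gaussianReal_map_add_const, zero_add] at this
      exact this
    rw [h3, Measure.map_map hΦ (((hW.measurable k).add_const _).prodMk hN)]
    congr 1
    ext ω y
    simp only [Φ, N, Function.comp_apply, hk, inner_add_left, real_inner_smul_left]
    field_simp
    ring
  rw [h1, h2]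
  exact (((gaussianReal_absolutelyContinuous _ hv).trans
    (gaussianReal_absolutelyContinuous' _ hv)).prod Measure.AbsolutelyContinuous.rfl).map hΦ

/-- Statements about the posterior hold almost everywhere for the marginal of the data; this
transfers them to the law of the data for one fixed parameter. -/
theorem dataKernel_absolutelyContinuous_comp (hW : IsWhiteNoise P W) (hC : C.IsPositive)
    (hμ : HasGaussianPairings μ C) (hδ : δ ≠ 0) (x : X) :
    dataKernel T P W δ x ≪ dataKernel T P W δ ∘ₘ μ := by
  refine Measure.AbsolutelyContinuous.mk fun s hs h => ?_
  rw [Measure.bind_apply hs (Kernel.aemeasurable _), lintegral_eq_zero_iff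
    (Kernel.measurable_coe _ hs)] at h
  obtain ⟨x', hx'⟩ := h.exists
  exact dataKernel_absolutelyContinuous hW hC hμ hδ x' x hx'

variable [CompleteSpace X] [CompleteSpace Y] [StandardBorelSpace X]

/-- Second moments of the posterior in a direction `h`, for which `y` gives the posterior mean. -/
theorem ae_posterior_lintegral_sq [IsFiniteKernel (dataKernel T P W δ)] (hW : IsWhiteNoise P W)
    (hC : C.IsPositive) (hμ : HasGaussianPairings μ C) {h : X} {y : Y}
    (hy : T (C (h - T.adjoint y)) = δ ^ 2 • y) (t : ℝ) :
    ∀ᵐ z ∂(dataKernel T P W δ ∘ₘ μ),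
      ∫⁻ x, ENNReal.ofReal ((t - ⟪x, h⟫_ℝ) ^ 2) ∂(posterior (dataKernel T P W δ) μ z) =
        ENNReal.ofReal ((t - z y) ^ 2 +
          (⟪C (h - T.adjoint y), h - T.adjoint y⟫_ℝ + δ ^ 2 * ‖y‖ ^ 2)) := by
  have := isMarkovKernel_dataKernel (T := T) (δ := δ) hW
  have hJ : Measurable fun p : X × Ω => (p.1, fun y => ⟪T p.1, y⟫_ℝ + δ * W y p.2) :=
    measurable_fst.prodMk (measurable_data hW)
  have hD : Measurable fun z : Y → ℝ => z y := measurable_pi_apply y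
  have hr : Measurable fun q : X × (Y → ℝ) => ⟪q.1, h⟫_ℝ - q.2 y :=
    ((measurable_inner_right h).comp measurable_fst).sub (hD.comp measurable_snd)
  have hform : IsLinearForm μ P W (fun p => ⟪p.1, h⟫_ℝ - (⟪T p.1, y⟫_ℝ + δ * W y p.2))
      (h - T.adjoint y) (-δ • y) := by
    refine ⟨hr.comp hJ, ?_⟩
    filter_upwards [(Measure.quasiMeasurePreserving_snd (μ := μ)).ae (hW.smul (-δ) y)] with p hp
    rw [hp, inner_sub_right, ContinuousLinearMap.adjoint_inner_right]
    ring
  have hdata : ∀ b, IsLinearForm μ P W (fun p => ⟪T p.1, b⟫_ℝ + δ * W b p.2)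
      (T.adjoint b) (δ • b) := fun b => by
    refine ⟨(measurable_pi_apply b).comp (measurable_data hW), ?_⟩
    filter_upwards [(Measure.quasiMeasurePreserving_snd (μ := μ)).ae (hW.smul δ b)] with p hp
    rw [hp, ContinuousLinearMap.adjoint_inner_right]
  -- By `hy`, the residual `⟪x, h⟫ - z y` is uncorrelated with every datum `z b`.
  have hind := hform.indepFun hW hC hμ hdata fun b => by
    rw [ContinuousLinearMap.adjoint_inner_right, hy, real_inner_smul_left, real_inner_smul_left,
      real_inner_smul_right]
    ring
  have hlaw := hform.map_eq hW hC hμ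
  rw [norm_smul, norm_neg, mul_pow, Real.norm_eq_abs, sq_abs] at hlaw
  have hv : 0 ≤ ⟪C (h - T.adjoint y), h - T.adjoint y⟫_ℝ + δ ^ 2 * ‖y‖ ^ 2 :=
    add_nonneg (hC.inner_nonneg_left _) (by positivity)
  have key := ae_posterior_lintegral_of_indepFun (k := dataKernel T P W δ) (μ := μ)
    (measurable_inner_right h) hD (by
      rw [compProd_dataKernel hW, indepFun_iff_map_prod_eq_prod_map_map hr.aemeasurable
        measurable_snd.aemeasurable, Measure.map_map (hr.prodMk measurable_snd) hJ,
        Measure.map_map hr hJ, Measure.map_map measurable_snd hJ]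
      exact hind.map_prod_eq_prod_map_map (hr.comp hJ).aemeasurable
        (measurable_data hW).aemeasurable) (ν := gaussianReal 0 _) (by
      rw [compProd_dataKernel hW, Measure.map_map hr hJ]
      exact hlaw) (f := fun s => ENNReal.ofReal ((t - s) ^ 2)) (by fun_prop)
  filter_upwards [key] with z hz
  rw [hz]
  simp_rw [← sub_sub]
  rw [lintegral_sq_gaussianReal, Real.coe_toNNReal _ hv]

/-- The term `δ² ‖y‖²` occurs twice: in the posterior variance, and as the variance of the posterior
mean `z y` under the law of the data. -/
theorem lintegral_posterior_sq [IsFiniteKernel (dataKernel T P W δ)] (hW : IsWhiteNoise P W)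
    (hC : C.IsPositive) (hμ : HasGaussianPairings μ C) (hδ : δ ≠ 0) {h : X} {y : Y}
    (hy : T (C (h - T.adjoint y)) = δ ^ 2 • y) (x' : X) :
    ∫⁻ z, ∫⁻ x, ENNReal.ofReal ((⟪x', h⟫_ℝ - ⟪x, h⟫_ℝ) ^ 2)
        ∂(posterior (dataKernel T P W δ) μ z) ∂(dataKernel T P W δ x') =
      ENNReal.ofReal ((⟪x', h⟫_ℝ - ⟪T x', y⟫_ℝ) ^ 2) + ENNReal.ofReal
        (⟪C (h - T.adjoint y), h - T.adjoint y⟫_ℝ + 2 * (δ ^ 2 * ‖y‖ ^ 2)) := by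
  have hv : 0 ≤ ⟪C (h - T.adjoint y), h - T.adjoint y⟫_ℝ + δ ^ 2 * ‖y‖ ^ 2 :=
    add_nonneg (hC.inner_nonneg_left _) (by positivity)
  set V := ⟪C (h - T.adjoint y), h - T.adjoint y⟫_ℝ + δ ^ 2 * ‖y‖ ^ 2 with hV
  have hms : Measurable fun z : Y → ℝ => ENNReal.ofReal ((⟪x', h⟫_ℝ - z y) ^ 2 + V) :=
    ((((measurable_pi_apply y).const_sub _).pow_const 2).add_const _).ennreal_ofReal
  rw [lintegral_congr_ae ((dataKernel_absolutelyContinuous_comp hW hC hμ hδ x').ae_eq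
    (ae_posterior_lintegral_sq hW hC hμ hy ⟪x', h⟫_ℝ)), dataKernel_apply hW,
    lintegral_map hms (measurable_data_right hW x')]
  have h1 : ∀ ω, ENNReal.ofReal ((⟪x', h⟫_ℝ - (⟪T x', y⟫_ℝ + δ * W y ω)) ^ 2 + V) =
      ENNReal.ofReal ((⟪x', h⟫_ℝ - ⟪T x', y⟫_ℝ - δ * W y ω) ^ 2) + ENNReal.ofReal V := fun ω => by
    rw [ENNReal.ofReal_add (sq_nonneg _) hv, sub_sub]
  simp_rw [h1]
  rw [lintegral_add_right _ measurable_const, lintegral_const, measure_univ, mul_one,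
    ← lintegral_map (f := fun s => ENNReal.ofReal ((⟪x', h⟫_ℝ - ⟪T x', y⟫_ℝ - s) ^ 2))
      (g := fun ω => δ * W y ω) (by fun_prop) ((hW.measurable y).const_mul δ)]
  have h2 : P.map (fun ω => δ * W y ω) =
      gaussianReal 0 (.mk (δ ^ 2) (sq_nonneg _) * ‖y‖₊ ^ 2) := by
    have := gaussianReal_map_const_mul (μ := 0) (v := ‖y‖₊ ^ 2) δ
    rw [← hW.law y, Measure.map_map (by fun_prop) (hW.measurable y), mul_zero] at this
    exact this
  rw [h2, lintegral_sq_gaussianReal, NNReal.coe_mul, NNReal.coe_mk, NNReal.coe_pow, coe_nnnorm,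
    ENNReal.ofReal_add (sq_nonneg _) (by positivity), add_assoc,
    ← ENNReal.ofReal_add (by positivity) hv, hV]
  congr 2
  ring

end Data

/-! ### The scaled Gaussian prior. -/

section Prior

variable {X : Type*} [NormedAddCommGroup X] [InnerProductSpace ℝ X]
  [MeasurableSpace X] [BorelSpace X] {μ : Measure X} {C : X →L[ℝ] X}

theorem IsCentredGaussian.hasGaussianPairings [CompleteSpace X] [SecondCountableTopology X]
    (h : IsCentredGaussian μ C) :
    HasGaussianPairings μ C := fun a => by
  have := h.gaussian
  have h1 := this.map_eq_gaussianReal (innerSL ℝ a)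
  have h2 : ∀ x, innerSL ℝ a x = ⟪x, a⟫_ℝ := fun x => by
    rw [innerSL_apply_apply, real_inner_comm]
  have hmean : ∫ x, innerSL ℝ a x ∂μ = 0 := by
    rw [ContinuousLinearMap.integral_comp_id_comm IsGaussian.integrable_id, h.mean, map_zero]
  have hvar : Var[innerSL ℝ a; μ] = ⟪C a, a⟫_ℝ := by
    rw [variance_of_integral_eq_zero (by fun_prop) hmean, ← h.cov]
    simp [sq]
  rw [hmean, hvar] at h1
  rw [← h1]
  congr 1
  ext x
  rw [h2]

theorem isProbabilityMeasure_prior [IsProbabilityMeasure μ] (α δ : ℝ) :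
    IsProbabilityMeasure (prior μ α δ) :=
  Measure.isProbabilityMeasure_map (by fun_prop)

theorem HasGaussianPairings.prior [CompleteSpace X] (h : HasGaussianPairings μ C) {α δ : ℝ} (hα : 0 < α) :
    HasGaussianPairings (prior μ α δ) ((δ ^ 2 / α) • C) := fun a => by
  have h1 := gaussianReal_map_const_mul (μ := 0) (v := Real.toNNReal ⟪C a, a⟫_ℝ) (δ / √α)
  rw [← h a, Measure.map_map (by fun_prop) (measurable_inner_right a), mul_zero] at h1
  rw [PosteriorContraction.prior, Measure.map_map (measurable_inner_right a) (by fun_prop)]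
  have h2 : (fun x => ⟪x, a⟫_ℝ) ∘ (fun x => (δ / √α) • x) =
      (fun s => δ / √α * s) ∘ fun x => ⟪x, a⟫_ℝ := by
    ext x
    simp [real_inner_smul_left]
  rw [h2, h1]
  congr 1
  rw [smul_apply, real_inner_smul_left, Real.toNNReal_mul (by positivity)]
  congr 1
  ext
  rw [Real.coe_toNNReal _ (by positivity), NNReal.coe_mk, div_pow, Real.sq_sqrt hα.le]

end Prior

end PosteriorContraction
namespace PosteriorContraction

/-! ### Bias and variance in the squared posterior contraction. -/

section Contraction

variable {X Y Ω : Type*} [NormedAddCommGroup X] [InnerProductSpace ℝ X] [CompleteSpace X]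
  [NormedAddCommGroup Y] [InnerProductSpace ℝ Y] [CompleteSpace Y]
  {T : X →L[ℝ] Y} {C₀ : X →L[ℝ] X} {ι κ : Type*} {e : HilbertBasis ι ℝ X}
  {c : ι → ℝ} {h : HilbertBasis κ ℝ X} {b : κ → ℝ} {α : ℝ} {Q : X →L[ℝ] X}

namespace SpectralData

/-- Needed to exchange sums over the eigenbasis with integrals. -/
theorem countable (s : SpectralData T C₀ e c h b) : Countable ι := by
  rw [← Set.countable_univ_iff]
  refine (Set.countable_iUnion fun n : ℕ => (s.fin (1 / (n + 1 : ℝ)) (by positivity)).countable).mono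
    fun i _ => ?_
  obtain ⟨n, hn⟩ := exists_nat_one_div_lt (s.pos i)
  exact Set.mem_iUnion.2 ⟨n, hn.le⟩

theorem sqrt_sqrt (s : SpectralData T C₀ e c h b) (x : X) :
    opFun Real.sqrt C₀ (opFun Real.sqrt C₀ x) = C₀ x := by
  have h1 := (s.sqrt_diag.mul s.sqrt_diag).eq (s.diag.congr fun i =>
    (Real.mul_self_sqrt (s.pos i).le).symm)
  rw [← _root_.mul_apply_eq_comp, h1]

theorem adjoint_opB (s : SpectralData T C₀ e c h b) (y : Y) :
    (opB T C₀).adjoint y = opFun Real.sqrt C₀ (T.adjoint y) := by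
  refine ext_inner_right ℝ fun x => ?_
  rw [ContinuousLinearMap.adjoint_inner_left, opB, ContinuousLinearMap.comp_apply,
    s.sqrt_diag.inner_comm, ContinuousLinearMap.adjoint_inner_left]

theorem resolvent_apply (s : SpectralData T C₀ e c h b) (hα : 0 < α)
    (hQ : DiagOn h (fun j => 1 / (α + b j)) Q) (x : X) : α • Q x + opH T C₀ (Q x) = x := by
  have h1 := ((DiagOn.one.smul α).add s.diagH).mul hQ
  have h2 := h1.eq (DiagOn.one.congr fun j => by
    have := s.nonnegH j
    field_simp)
  have h3 := congrArg (fun A : X →L[ℝ] X => A x) h2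
  simpa [_root_.mul_apply_eq_comp] using h3

/-- The element of `Y` that gives the posterior mean in the direction `x`. -/
theorem posterior_mean (s : SpectralData T C₀ e c h b) (hα : 0 < α)
    (hQ : DiagOn h (fun j => 1 / (α + b j)) Q) (x : X) :
    opFun Real.sqrt C₀ (x - T.adjoint (opB T C₀ (Q (opFun Real.sqrt C₀ x)))) =
      α • Q (opFun Real.sqrt C₀ x) := by
  have h1 := s.resolvent_apply hα hQ (opFun Real.sqrt C₀ x)
  rw [map_sub, ← s.adjoint_opB, sub_eq_iff_eq_add]
  exact h1.symm

theorem inner_biasOp (s : SpectralData T C₀ e c h b) (hQ : DiagOn h (fun j => 1 / (α + b j)) Q)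
    (x z : X) : ⟪z, x⟫_ℝ - ⟪T z, opB T C₀ (Q (opFun Real.sqrt C₀ x))⟫_ℝ =
      ⟪x, biasOp T C₀ Q z⟫_ℝ := by
  simp only [biasOp, sub_apply, one_apply_eq_self, ContinuousLinearMap.comp_apply, inner_sub_right]
  rw [← s.sqrt_diag.inner_comm, ← hQ.inner_comm, ContinuousLinearMap.adjoint_inner_right,
    real_inner_comm z, real_inner_comm (T z)]

variable [MeasurableSpace Ω] {P : Measure Ω} [IsProbabilityMeasure P] {W : Y → Ω → ℝ}
  [MeasurableSpace X] [BorelSpace X] [SecondCountableTopology X] {μ₀ : Measure X}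
  [IsProbabilityMeasure μ₀] {δ : ℝ}

theorem SPC_le (s : SpectralData T C₀ e c h b) (hW : IsWhiteNoise P W) (hC₀ : C₀.IsPositive)
    (hμ₀ : IsCentredGaussian μ₀ C₀) (hα : 0 < α) (hδ : δ ≠ 0)
    (hQ : DiagOn h (fun j => 1 / (α + b j)) Q) (xs : X) :
    SPC T P W μ₀ xs α δ ≤ ENNReal.ofReal (‖biasOp T C₀ Q xs‖ ^ 2) + 2 * ENNReal.ofReal (δ ^ 2) *
      ∑' i, ENNReal.ofReal ⟪Q (opFun Real.sqrt C₀ (e i)), opFun Real.sqrt C₀ (e i)⟫_ℝ := by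
  have := s.countable
  have := isProbabilityMeasure_prior (μ := μ₀) α δ
  have := isMarkovKernel_dataKernel (T := T) (δ := δ) hW
  have hC : ((δ ^ 2 / α) • C₀).IsPositive := hC₀.smul_of_nonneg (by positivity)
  have hμ := hμ₀.hasGaussianPairings.prior (δ := δ) hα
  have hmeas : ∀ i, Measurable fun x : X => ENNReal.ofReal ((⟪xs, e i⟫_ℝ - ⟪x, e i⟫_ℝ) ^ 2) :=
    fun i => (((measurable_inner_right (e i)).const_sub _).pow_const 2).ennreal_ofReal
  have hsum : ∀ x, ENNReal.ofReal (‖xs - x‖ ^ 2) =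
      ∑' i, ENNReal.ofReal ((⟪xs, e i⟫_ℝ - ⟪x, e i⟫_ℝ) ^ 2) := fun x => by
    rw [← tsum_ofReal_sq_inner e]
    exact tsum_congr fun i => by rw [← inner_sub_left, real_inner_comm]
  have hmain : SPC T P W μ₀ xs α δ = ∑' i, ∫⁻ z, ∫⁻ x,
      ENNReal.ofReal ((⟪xs, e i⟫_ℝ - ⟪x, e i⟫_ℝ) ^ 2)
        ∂(posterior (dataKernel T P W δ) (prior μ₀ α δ) z) ∂(dataKernel T P W δ xs) := by
    rw [← lintegral_tsum fun i => (hmeas i).lintegral_kernel.aemeasurable]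
    refine lintegral_congr fun z => ?_
    rw [← lintegral_tsum fun i => (hmeas i).aemeasurable]
    exact lintegral_congr fun x => hsum x
  rw [hmain, ← tsum_ofReal_sq_inner e, ← ENNReal.tsum_mul_left, ← ENNReal.tsum_add]
  refine ENNReal.tsum_le_tsum fun i => ?_
  set p := Q (opFun Real.sqrt C₀ (e i)) with hp
  have hmean := s.posterior_mean hα hQ (e i)
  rw [← hp] at hmean
  -- Applying `T` gives `δ² B p`, so `y = B p` solves the equation for the posterior mean in the
  -- direction `e i`.
  have hCx : ((δ ^ 2 / α) • C₀) (e i - T.adjoint (opB T C₀ p)) =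
      δ ^ 2 • opFun Real.sqrt C₀ p := by
    rw [smul_apply, ← s.sqrt_sqrt, hmean, map_smul, smul_smul, div_mul_cancel₀ _ hα.ne']
  rw [lintegral_posterior_sq hW hC hμ hδ (y := opB T C₀ p) (by rw [hCx, map_smul]; rfl),
    hp, s.inner_biasOp hQ, ← hp]
  refine add_le_add_right ?_ _
  have h2 : (2 : ℝ≥0∞) = ENNReal.ofReal 2 := by simp
  rw [h2, ← ENNReal.ofReal_mul zero_le_two, ← ENNReal.ofReal_mul (by positivity)]
  refine ENNReal.ofReal_le_ofReal ?_
  have hp2 : ⟪p, opFun Real.sqrt C₀ (e i)⟫_ℝ = α * ‖p‖ ^ 2 + ‖opB T C₀ p‖ ^ 2 := by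
    have := s.resolvent_apply hα hQ (opFun Real.sqrt C₀ (e i))
    rw [← hp] at this
    rw [← this, inner_add_right, real_inner_smul_right, real_inner_self_eq_norm_sq,
      real_inner_comm, opH_inner, real_inner_self_eq_norm_sq]
  rw [hCx, real_inner_smul_left, s.sqrt_diag.inner_comm, hmean, real_inner_smul_right,
    real_inner_self_eq_norm_sq, hp2]
  -- The variances add up to `δ² (α ‖p‖² + 2 ‖B p‖²)`; one more `δ² α ‖p‖²` completes this to `2 δ²
  -- ⟪p, C₀^{1/2} e i⟫`.
  nlinarith [mul_nonneg (sq_nonneg δ) (mul_nonneg hα.le (sq_nonneg ‖p‖))]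

end SpectralData

variable [MeasurableSpace Ω] {P : Measure Ω} [IsProbabilityMeasure P] {W : Y → Ω → ℝ}
  [MeasurableSpace X] [BorelSpace X] [SecondCountableTopology X] {μ₀ : Measure X}
  [IsProbabilityMeasure μ₀] {δ : ℝ}

theorem SpectralData.SPC_le_spcBound {φ ψ : ℝ → ℝ} {m M K : ℝ} (s : SpectralData T C₀ e c h b)
    (hW : IsWhiteNoise P W) (hC₀ : C₀.IsPositive) (hμ₀ : IsCentredGaussian μ₀ C₀)
    (hl : LinkCondition T C₀ ψ m M) (hK : 1 / m ≤ K) {xs : X}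
    (hbias : ∀ α, 0 < α → ∀ Q, DiagOn h (fun j => 1 / (α + b j)) Q →
      ‖biasOp T C₀ Q xs‖ ≤ K * φ (fZero ψ α ^ 2)) (hα : 0 < α) (hδ : 0 < δ) :
    SPC T P W μ₀ xs α δ ≤ ENNReal.ofReal (K ^ 2) * spcBound T C₀ φ ψ α δ := by
  have hm := hl.m_pos
  have hQ := DiagOn.ringInverse hα s.nonnegH s.diagH
  have hK2 : ENNReal.ofReal ((1 / m) ^ 2) ≤ ENNReal.ofReal (K ^ 2) :=
    ENNReal.ofReal_le_ofReal (pow_le_pow_left₀ (by positivity) hK 2)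
  refine (s.SPC_le hW hC₀ hμ₀ hα hδ.ne' hQ xs).trans ?_
  rw [spcBound, mul_add]
  refine add_le_add ?_ ?_
  · rw [← ENNReal.ofReal_mul (sq_nonneg _), ← mul_pow]
    exact ENNReal.ofReal_le_ofReal (pow_le_pow_left₀ (norm_nonneg _) (hbias α hα _ hQ) 2)
  · rw [mul_left_comm]
    exact mul_le_mul_right ((s.trace_le hl hα hQ e).trans (mul_le_mul_left hK2 _)) _

end Contraction

end PosteriorContraction

/-! ### Assembly of the bias and trace bounds. -/

theorem theorem5p1
    {X Y Ω : Type*}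
    [NormedAddCommGroup X] [InnerProductSpace ℝ X] [CompleteSpace X]
    [MeasurableSpace X] [BorelSpace X] [SecondCountableTopology X]
    [NormedAddCommGroup Y] [InnerProductSpace ℝ Y] [CompleteSpace Y]
    [MeasurableSpace Ω] (P : Measure Ω) [IsProbabilityMeasure P]
    -- forward operator, noise covariance, whitened operator
    (K : X →L[ℝ] Y) (hK : IsCompactOperator K)
    (Sig : Y →L[ℝ] Y) (hSig : Sig.IsPositive) (hSig_inj : Function.Injective Sig)
    (T : X →L[ℝ] Y) (hT : IsWhitened K Sig T)
    -- white noise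
    (W : Y → Ω → ℝ) (hW : IsWhiteNoise P W)
    -- prior
    (C₀ : X →L[ℝ] X) (hC₀ : C₀.IsPositive) (hC₀_compact : IsCompactOperator C₀)
    (hC₀_inj : Function.Injective C₀) (hC₀_trace : opTrace C₀ ≠ ∞)
    (μ₀ : Measure X) [IsProbabilityMeasure μ₀] (hμ₀ : IsCentredGaussian μ₀ C₀)
    -- link condition and source condition
    (ψ φ : ℝ → ℝ) (m M : ℝ) (hlink : LinkCondition T C₀ ψ m M)
    (hφ : IsIndexFun φ) (xs : X) (hxs : xs ∈ sourceSet φ C₀)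
    -- saturation
    (hsat : Prec φ fun t => Theta ψ t ^ 2) :
    -- `κ²` is the constant in front of the bound
    ∀ κ : ℝ,
      ((κ = M / m ∧ (RegularCase φ ψ ∨ LowOrderCase φ ∨
          ∃ u, 1 < u ∧ LiftingConditionEq T C₀ ψ m M u ∧ HighOrderIndex φ ψ u)) ∨
        (κ = max M (1 / m) / m ∧
          ∃ u, 1 < u ∧ LiftingCondition T C₀ ψ m M u ∧ HighOrderIndex φ ψ u)) →
      (∀ α δ, 0 < α → 0 < δ →
        SPC T P W μ₀ xs α δ ≤ ENNReal.ofReal (κ ^ 2) * spcBound T C₀ φ ψ α δ) ∧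
      (∀ δ, 0 < δ →
        (⨅ α ∈ Ioi (0 : ℝ), SPC T P W μ₀ xs α δ) ≤
          ENNReal.ofReal (κ ^ 2) *
            (⨅ α ∈ Ioi (0 : ℝ), spcBound T C₀ φ ψ α δ)) := by
  intro κ hκ
  obtain ⟨v, hv, rfl⟩ := hxs
  obtain ⟨ι, τ, e, c, h, b, s⟩ := exists_spectralData T hC₀ hC₀_compact hC₀_inj
  have hm := hlink.m_pos
  have hM := hlink.le_M
  have hφα : ∀ α, 0 ≤ φ (fZero ψ α ^ 2) := fun α => hφ.nonneg (sq_nonneg _)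
  -- This is all that the trace term, the regular case and the equality case require of `κ`.
  have hκm : 1 / m ≤ κ := by
    rcases hκ with ⟨rfl, -⟩ | ⟨rfl, -⟩
    · exact div_le_div_of_nonneg_right hM hm.le
    · exact div_le_div_of_nonneg_right (hM.trans (le_max_left _ _)) hm.le
  have hdiv : ∀ α, φ (fZero ψ α ^ 2) / m ≤ κ * φ (fZero ψ α ^ 2) := fun α => by
    rw [div_eq_mul_one_div, mul_comm]
    exact mul_le_mul_of_nonneg_right hκm (hφα α)
  have hbias : ∀ α, 0 < α → ∀ Q, DiagOn h (fun j => 1 / (α + b j)) Q →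
      ‖biasOp T C₀ Q (opFun φ C₀ v)‖ ≤ κ * φ (fZero ψ α ^ 2) := by
    intro α hα Q hQ
    rcases hκ with ⟨hκ, hreg | hlow | ⟨u, hu, hlift, hhigh⟩⟩ | ⟨hκ, u, hu, hlift, hhigh⟩
    · exact (s.bias_regular hlink hφ hreg hα hQ hv).trans (hdiv α)
    · rw [hκ]
      exact s.bias_low hlink hφ hsat hlow hα hQ hv
    · exact (s.bias_high_eq hlink hφ hsat hu hlift hhigh hα hQ hv).trans (hdiv α)
    · refine (s.bias_high hlink hφ hsat hu hlift hhigh hα hQ hv).trans ?_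
      rw [hκ, div_eq_mul_one_div, mul_comm]
      refine mul_le_mul_of_nonneg_right ?_ (hφα α)
      rw [sq, ← div_div]
      exact div_le_div_of_nonneg_right (le_max_right _ _) hm.le
  have hmain : ∀ α δ, 0 < α → 0 < δ → SPC T P W μ₀ (opFun φ C₀ v) α δ ≤
      ENNReal.ofReal (κ ^ 2) * spcBound T C₀ φ ψ α δ := fun α δ hα hδ =>
    s.SPC_le_spcBound hW hC₀ hμ₀ hlink hκm hbias hα hδ
  refine ⟨hmain, fun δ hδ => ?_⟩
  have hκ0 : 0 < κ := (one_div_pos.2 hm).trans_le hκm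
  have h0 : ENNReal.ofReal (κ ^ 2) ≠ 0 := (ENNReal.ofReal_pos.2 (by positivity)).ne'
  rw [ENNReal.mul_iInf_of_ne h0 ENNReal.ofReal_ne_top]
  refine iInf_mono fun α => ?_
  rw [ENNReal.mul_iInf_of_ne h0 ENNReal.ofReal_ne_top]
  exact iInf_mono fun hα => hmain α δ hα hδ
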